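/- Let $\mathcal H_1,\mathcal H_2$ be real Hilbert spaces, let $F\colon\mathcal H_1\to\mathcal H_1$ be $L$-Lipschitz continuous and $\alpha$-strongly monotone ($\alpha>0$ and $\langle Fx-Fy,x-y\rangle\ge\alpha\|x-y\|^2$ for all $x,y$), and let $A\colon\mathcal H_1\to\mathcal H_2$ be a nonzero bounded linear operator. Let $C_i\subseteq\mathcal H_1$ ($i\in I=\{1,\dots,m\}$) and $Q_j\subseteq\mathcal H_2$ ($j\in J=\{1,\dots,n\}$) be closed and convex, $C:=\bigcap_{i\in I}C_i$, $Q:=\bigcap_{j\in J}Q_j$, and assume that $$S:=\{z\in\mathcal H_1 : z\in C,\ Az\in Q\}\neq\emptyset .$$ Write $\operatorname{Fix}U:=\{z: U(z)=z\}$ and $d(x,D):=\inf_{z\in D}\|x-z\|$. For $\rho\ge0$, an operator $U$ on a Hilbert space is called $\rho$-SQNE if $\operatorname{Fix}U\ne\emptyset$ and $\|U(x)-z\|^2\le\|x-z\|^2-\rho\|U(x)-x\|^2$ for all $x$ and all $z\in\operatorname{Fix}U$. For each $k=0,1,2,\dots$ let $\mathcal U_k\colon\mathcal H_1\to\mathcal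 H_1$ be $\beta_k$-SQNE with $C\subseteq\operatorname{Fix}\mathcal U_k$ and $\inf_k\beta_k>0$, let $\mathcal V_k\colon\mathcal H_2\to\mathcal H_2$ be $\gamma_k$-SQNE with $Q\subseteq\operatorname{Fix}\mathcal V_k$ and $\inf_k\gamma_k>0$, and let $\sigma_k\colon\mathcal H_1\to[1,\infty)$ satisfy $\sigma_k\le\tau_k$, where $$\tau_k(x):=\left(\frac{\|A\|\,\|\mathcal V_k(Ax)-Ax\|}{\|A^*(\mathcal V_k(Ax)-Ax)\|}\right)^2\ \text{ if }\mathcal V_k(Ax)\ne Ax,\qquad \tau_k(x):=1\ \text{ otherwise.}$$ Let $\mathcal L_k(x):=x+\frac{\sigma_k(x)}{\|A\|^2}A^*(\mathcal V_k(Ax)-Ax)$ be the extrapolated Landweber operator. Let the operators $T_k\colon\mathcal H_1\to\mathcal H_1$ be given in one of the following three ways: (i) (product) $T_k(x)=x+\frac{1+\rho_k}{2}\big(\mathcal U_k(\mathcal L_k(x))-x\big)$, where $0\le\rho_k\le\big(\frac1{\beta_k}+\frac1{\gamma_k}\big)^{-1}$; (ii) (simultaneous) $T_k(x)=x+\frac{1+\rho_k}{2}\big(\eta_k\,\mathcal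 U_k(x)+(1-\eta_k)\mathcal L_k(x)-x\big)$, where $0<\eta\le\eta_k\le1-\eta$ and $0\le\rho_k\le\big(\frac{\eta_k}{\beta_k+1}+\frac{1-\eta_k}{\gamma_k+1}\big)^{-1}-1$; (iii) (alternating) $T_{2k}(x)=x+\frac{1+\beta_k}{2}(\mathcal U_k(x)-x)$ and $T_{2k+1}(x)=x+\frac{1+\gamma_k}{2}(\mathcal L_k(x)-x)$. Let $\varepsilon>0$, $\alpha_k\in[\varepsilon,2-\varepsilon]$ and $\lambda_k\ge0$, let $u_0\in\mathcal H_1$ be arbitrary, and put, for $k=0,1,2,\dots$, $$u_{k+1}:=R_k(u_k-\lambda_kF(u_k)),\qquad R_k:=\mathrm{Id}+\alpha_k(P_{H_k}-\mathrm{Id}),$$ where $P_{H_k}$ is the metric projection onto $H_k:=\{z\in\mathcal H_1:\langle u_k-T_k(u_k),z-T_k(u_k)\rangle\le0\}$. Let $I_k\subseteq I$ and $J_k\subseteq J$ be nonempty ($k\ge0$), and assume that for all bounded sequences $(x_k)\subseteq\mathcal H_1$ and $(y_k)\subseteq\mathcal H_2$, $$\lim_k\|\mathcal U_k(x_k)-x_k\|=0\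 \Longrightarrow\ \lim_k\max_{i\in I_k}d(x_k,C_i)=0,$$ $$\lim_k\|\mathcal V_k(y_k)-y_k\|=0\ \Longrightarrow\ \lim_k\max_{j\in J_k}d(y_k,Q_j)=0 .$$ Assume also that, for some $s\ge1$, $I=I_k\cup\dots\cup I_{k+s-1}$ and $J=J_k\cup\dots\cup J_{k+s-1}$ for all $k\ge0$; that the range $\mathcal R(A)$ is closed; and that the families $\{A^{-1}(Q),C_1,\dots,C_m\}$ and $\{\mathcal R(A),Q_1,\dots,Q_n\}$ are boundedly regular, where a finite family $\{D_i\}$ is called boundedly regular if for every bounded sequence $(x_k)$, $\max_id(x_k,D_i)\to0$ implies $d(x_k,\bigcap_iD_i)\to0$. Finally, assume that $\lim_k\lambda_k=0$. Then $\lim_{k\to\infty}d(u_k,S)=0$. If, in addition, $\sum_{k=0}^\infty\lambda_k=\infty$, then there is exactly one $x^*\in S$ such that $\langle Fx^*,z-x^*\rangle\ge0$ for all $z\in S$, and $u_k\to x^*$ in norm. -/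

import Mathlib

open Set Filter Topology
open scoped NNReal

noncomputable section

namespace SplitVI

section OneSpace

variable {H : Type*} [NormedAddCommGroup H] [InnerProductSpace ℝ H]

/-- `F` is `a`-strongly monotone. -/
def IsStronglyMonotone (a : ℝ) (F : H → H) : Prop :=
  0 < a ∧ ∀ x y : H, a * ‖x - y‖ ^ 2 ≤ inner ℝ (F x - F y) (x - y)

/-- `x` solves the variational inequality `VI(F, S)`. -/
def IsVISolution (F : H → H) (S : Set H) (x : H) : Prop :=
  x ∈ S ∧ ∀ z ∈ S, 0 ≤ inner ℝ (F x) (z - x)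

/-- `U` is a `ρ`-strongly quasi-nonexpansive operator (with a fixed point). -/
structure IsSQNE (ρ : ℝ) (U : H → H) : Prop where
  nonneg : 0 ≤ ρ
  nonempty_fix : (Function.fixedPoints U).Nonempty
  sq_norm_le : ∀ x : H, ∀ z ∈ Function.fixedPoints U,
    ‖U x - z‖ ^ 2 ≤ ‖x - z‖ ^ 2 - ρ * ‖U x - x‖ ^ 2

/-- The `a`-relaxation `Id + a (U - Id)` of `U`. -/
def relax (a : ℝ) (U : H → H) (x : H) : H :=
  x + a • (U x - x)

open Classical in
/-- The metric projection onto `S`: a point of `S` nearest to `x`. It is the unique such point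
when `S` is a nonempty closed convex subset of a Hilbert space, which is the only case in which it
is used (the value `x` when there is no nearest point is immaterial). -/
def metricProj (S : Set H) (x : H) : H :=
  if h : ∃ p ∈ S, ∀ z ∈ S, ‖x - p‖ ≤ ‖x - z‖ then h.choose else x

/-- The half-space `{z | ⟨x - x', z - x'⟩ ≤ 0}`; it is the whole space when `x = x'`. -/
def halfSpace (x x' : H) : Set H :=
  {z | inner ℝ (x - x') (z - x') ≤ 0}

/-- The outer approximation method `u (k+1) = R_k (u k - lam k • F (u k))`, where `R_k` is the
`a k`-relaxation of the metric projection onto the half-space determined by `u k` and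
`T k (u k)`. The starting point `u 0` is arbitrary. -/
def IsOuterApproximation (F : H → H) (T : ℕ → H → H) (a lam : ℕ → ℝ) (u : ℕ → H) : Prop :=
  ∀ k, u (k + 1) =
    relax (a k) (metricProj (halfSpace (u k) (T k (u k)))) (u k - lam k • F (u k))

/-- Bounded regularity of a finite nonempty family of sets. -/
def BoundedlyRegular {ι : Type*} [Fintype ι] [Nonempty ι] (C : ι → Set H) : Prop :=
  ∀ x : ℕ → H, Bornology.IsBounded (range x) →
    Tendsto (fun k => Finset.univ.sup' Finset.univ_nonempty
      (fun i => Metric.infDist (x k) (C i))) atTop (𝓝 0) →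
    Tendsto (fun k => Metric.infDist (x k) (⋂ i, C i)) atTop (𝓝 0)

/-- The regularity condition linking a sequence of operators `U k`, a family of sets `C i` and
a sequence of nonempty index sets `I k`: for every bounded sequence `x`, if
`‖U k (x k) - x k‖ → 0`, then `max_{i ∈ I k} d(x k, C i) → 0`. -/
def RegularAlong {ι : Type*} (U : ℕ → H → H) (C : ι → Set H) (I : ℕ → Finset ι)
    (hI : ∀ k, (I k).Nonempty) : Prop :=
  ∀ x : ℕ → H, Bornology.IsBounded (range x) →
    Tendsto (fun k => ‖U k (x k) - x k‖) atTop (𝓝 0) →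
    Tendsto (fun k => (I k).sup' (hI k) (fun i => Metric.infDist (x k) (C i))) atTop (𝓝 0)

/-- (i) Product operators. Here `L k` stands for the `k`-th extrapolated Landweber operator. -/
def IsProductMethod (U L : ℕ → H → H) (β γ : ℕ → ℝ) (T : ℕ → H → H) : Prop :=
  ∃ ρ : ℕ → ℝ, (∀ k, 0 ≤ ρ k ∧ ρ k ≤ (1 / β k + 1 / γ k)⁻¹) ∧
    ∀ k x, T k x = relax ((1 + ρ k) / 2) (fun y => U k (L k y)) x

/-- (ii) Simultaneous operators. -/
def IsSimultaneousMethod (U L : ℕ → H → H) (β γ : ℕ → ℝ) (T : ℕ → H → H) : Prop :=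
  ∃ (η₀ : ℝ) (η ρ : ℕ → ℝ), 0 < η₀ ∧ (∀ k, η₀ ≤ η k ∧ η k ≤ 1 - η₀) ∧
    (∀ k, 0 ≤ ρ k ∧ ρ k ≤ (η k / (β k + 1) + (1 - η k) / (γ k + 1))⁻¹ - 1) ∧
    ∀ k x, T k x = relax ((1 + ρ k) / 2) (fun y => η k • U k y + (1 - η k) • L k y) x

/-- (iii) Alternating operators. -/
def IsAlternatingMethod (U L : ℕ → H → H) (β γ : ℕ → ℝ) (T : ℕ → H → H) : Prop :=
  ∀ k x, T (2 * k) x = relax ((1 + β k) / 2) (U k) x ∧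
    T (2 * k + 1) x = relax ((1 + γ k) / 2) (L k) x

end OneSpace

/-- A sequence of index sets is `s`-intermittent: `I k ∪ ⋯ ∪ I (k + s - 1)` is everything. -/
def IsIntermittent {m : ℕ} (s : ℕ) (I : ℕ → Finset (Fin m)) : Prop :=
  ∀ k, (Finset.range s).biUnion (fun l => I (k + l)) = Finset.univ

section TwoSpaces

variable {H₁ H₂ : Type*} [NormedAddCommGroup H₁] [InnerProductSpace ℝ H₁] [CompleteSpace H₁]
  [NormedAddCommGroup H₂] [InnerProductSpace ℝ H₂] [CompleteSpace H₂]

/-- The solution set `C ∩ A⁻¹(Q)`, `C = ⋂ C i`, `Q = ⋂ Q j`, of the split convex feasibility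
problem. -/
def solutionSet {m n : ℕ} (A : H₁ →L[ℝ] H₂) (C : Fin m → Set H₁) (Q : Fin n → Set H₂) : Set H₁ :=
  {z | z ∈ ⋂ i, C i ∧ A z ∈ ⋂ j, Q j}

/-- The extrapolated Landweber operator corresponding to `V` and `σ`. -/
def landweber (A : H₁ →L[ℝ] H₂) (σ : H₁ → ℝ) (V : H₂ → H₂) (x : H₁) : H₁ :=
  x + (σ x / ‖A‖ ^ 2) • (ContinuousLinearMap.adjoint A) (V (A x) - A x)

open Classical in
/-- The upper bound `τ` for the extrapolation functionals. -/
def extrapolationBound (A : H₁ →L[ℝ] H₂) (V : H₂ → H₂) (x : H₁) : ℝ :=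
  if V (A x) = A x then 1
  else (‖A‖ * ‖V (A x) - A x‖ / ‖(ContinuousLinearMap.adjoint A) (V (A x) - A x)‖) ^ 2

end TwoSpaces

end SplitVI

end

/-! Each `T k` is a cutter for the solution set `S`, so `S` lies in the half-space `H_k`. With `v_k
= u_k - λ_k F(u_k)` and `e_k = ‖P_{H_k} v_k - v_k‖`, the relaxed projection then brings `v_k` closer
to every point of `S`, with a gain of at least `ε² e_k²` in squared distance. Strong monotonicity
keeps the iterates bounded once `λ_k` is small, so the gradient step costs only a null sequence
`r_k`, and `d(u_{k+1}, S)² ≤ d(u_k, S)² + r_k - ε² e_k²`.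

No summability of `r_k` is available. Convergence comes from a block argument
(`tendsto_zero_of_descent`), which requires that `d(u_k, S)` be small whenever `e` is small along
`p` consecutive indices. Small `e` gives small displacements `T k (u k) - u k` and small steps. The
predicate `Controls`, an ε-δ form of the regularity of operators, passes from `U` and `V` to `T`
through the Landweber transform, products, convex combinations, relaxations and interleaving.
Intermittency then makes all distances to the constraint sets small. Closed range (through the open
mapping theorem) and bounded regularity turn this into smallness of `d(u_k, S)`.

For norm convergence, the variational inequality is tested at the projection of `u_k` onto `S`. This
yields `‖u_{k+1} - x*‖² ≤ (1 - λ_k α)‖u_k - x*‖² + λ_k b_k` with `b_k → 0`, which forces convergence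
when `∑ λ_k = ∞`. Existence of `x*` is Banach's fixed point theorem. -/

open Set Filter Topology
open scoped NNReal

namespace SplitVI

/-! ### Strongly quasi-nonexpansive operators: relaxation, product, convex combination -/

section Cutters

variable {H : Type*} [NormedAddCommGroup H] [InnerProductSpace ℝ H]

/-- The inequality characterizing `ρ`-strong quasi-nonexpansivity, required for the points of a
given set `S` instead of all fixed points. For `ρ = 1` this says that `W` is a cutter. -/
def IsSQNEOn (ρ : ℝ) (S : Set H) (W : H → H) : Prop :=
  ∀ x, ∀ z ∈ S, (1 + ρ) / 2 * ‖W x - x‖ ^ 2 ≤ inner ℝ (W x - x) (z - x)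

lemma norm_sub_sq_expand (w x z : H) :
    ‖w - z‖ ^ 2 = ‖x - z‖ ^ 2 - 2 * inner ℝ (w - x) (z - x) + ‖w - x‖ ^ 2 := by
  have h : w - z = (w - x) - (z - x) := by abel
  rw [h, norm_sub_sq_real, norm_sub_rev x z]
  ring

lemma IsSQNE.isSQNEOn {ρ : ℝ} {U : H → H} (h : IsSQNE ρ U) {S : Set H}
    (hS : S ⊆ Function.fixedPoints U) : IsSQNEOn ρ S U := by
  intro x z hz
  have h1 := h.sq_norm_le x z (hS hz)
  rw [norm_sub_sq_expand (U x) x z] at h1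
  linarith

lemma relax_sub (a : ℝ) (U : H → H) (x : H) : relax a U x - x = a • (U x - x) := by
  simp [relax]

/-- Relaxing a strongly quasi-nonexpansive operator by `(1 + ρ) / 2` gives a cutter. -/
lemma IsSQNEOn.relax {ρ : ℝ} {S : Set H} {W : H → H} (h : IsSQNEOn ρ S W) (hρ : 0 ≤ ρ) :
    IsSQNEOn 1 S (relax ((1 + ρ) / 2) W) := by
  intro x z hz
  have h1 := mul_le_mul_of_nonneg_left (h x z hz) (by linarith [hρ] : 0 ≤ (1 + ρ) / 2)
  rw [relax_sub, norm_smul, inner_smul_left, mul_pow, Real.norm_eq_abs, sq_abs]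
  simp only [conj_trivial]
  linarith

lemma norm_sub_le_relax {ρ : ℝ} (hρ : 0 ≤ ρ) (W : H → H) (x : H) :
    ‖W x - x‖ ≤ 2 * ‖relax ((1 + ρ) / 2) W x - x‖ := by
  rw [relax_sub, norm_smul, Real.norm_eq_abs, abs_of_nonneg (by linarith)]
  linarith [mul_nonneg hρ (norm_nonneg (W x - x))]

lemma IsSQNEOn.norm_sq_le {ρ : ℝ} {S : Set H} {W : H → H} (h : IsSQNEOn ρ S W)
    {x z : H} (hz : z ∈ S) : ‖W x - z‖ ^ 2 ≤ ‖x - z‖ ^ 2 - ρ * ‖W x - x‖ ^ 2 := by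
  rw [norm_sub_sq_expand (W x) x z]
  linarith [h x z hz]

/-- Adding the inequalities for `U` at `L x` and for `L` at `x` eliminates the intermediate `‖L x -
z‖²`. Keeping both displacements on the left serves twice: for the constant of the product, and for
recovering each factor's displacement from that of the product. -/
lemma two_inner_comp_ge {β γ : ℝ} {S : Set H} {U L : H → H}
    (hU : IsSQNEOn β S U) (hL : IsSQNEOn γ S L) (x : H) {z : H} (hz : z ∈ S) :
    ‖U (L x) - x‖ ^ 2 + γ * ‖L x - x‖ ^ 2 + β * ‖U (L x) - L x‖ ^ 2
      ≤ 2 * inner ℝ (U (L x) - x) (z - x) := by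
  have h1 := hU.norm_sq_le (x := L x) hz
  have h2 := hL.norm_sq_le (x := x) hz
  have h3 := norm_sub_sq_expand (U (L x)) x z
  linarith

lemma IsSQNEOn.comp {β γ ρ : ℝ} (hβ : 0 < β) (hγ : 0 < γ)
    (hρ : ρ ≤ (1 / β + 1 / γ)⁻¹) {S : Set H} {U L : H → H}
    (hU : IsSQNEOn β S U) (hL : IsSQNEOn γ S L) : IsSQNEOn ρ S (fun y => U (L y)) := by
  intro x z hz
  have h1 := two_inner_comp_ge hU hL x hz
  have h2 : ‖U (L x) - x‖ ≤ ‖L x - x‖ + ‖U (L x) - L x‖ := by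
    have := norm_add_le (L x - x) (U (L x) - L x)
    rwa [add_comm (L x - x), sub_add_sub_cancel] at this
  set a := ‖L x - x‖
  set b := ‖U (L x) - L x‖
  set w := ‖U (L x) - x‖
  have hw : 0 ≤ w := norm_nonneg _
  have h3 : w ^ 2 ≤ (a + b) ^ 2 := pow_le_pow_left₀ hw h2 2
  have h4 : (1 / β + 1 / γ)⁻¹ = β * γ / (β + γ) := by field_simp; ring
  rw [h4, le_div_iff₀ (by positivity)] at hρ
  have h5 : ρ * w ^ 2 ≤ γ * a ^ 2 + β * b ^ 2 := by
    have hs : 0 < β + γ := by positivity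
    have h6 : ρ * (β + γ) * w ^ 2 ≤ β * γ * (a + b) ^ 2 :=
      mul_le_mul hρ h3 (by positivity) (by positivity)
    have h7 : (β + γ) * (ρ * w ^ 2) ≤ (β + γ) * (γ * a ^ 2 + β * b ^ 2) := by
      -- The harmonic constant is optimal here: `(β + γ)(γ a² + β b²) - β γ (a + b)² = (γ a - β
      -- b)²`.
      nlinarith [sq_nonneg (γ * a - β * b)]
    exact le_of_mul_le_mul_left h7 hs
  show (1 + ρ) / 2 * w ^ 2 ≤ _
  linarith

lemma inner_combination_ge {β γ η : ℝ} (hη0 : 0 ≤ η) (hη1 : η ≤ 1) {S : Set H} {U L : H → H}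
    (hU : IsSQNEOn β S U) (hL : IsSQNEOn γ S L) (x : H) {z : H} (hz : z ∈ S) :
    η * ((1 + β) / 2 * ‖U x - x‖ ^ 2) + (1 - η) * ((1 + γ) / 2 * ‖L x - x‖ ^ 2)
      ≤ inner ℝ (η • U x + (1 - η) • L x - x) (z - x) := by
  have h1 := mul_le_mul_of_nonneg_left (hU x z hz) hη0
  have h2 := mul_le_mul_of_nonneg_left (hL x z hz) (sub_nonneg.2 hη1)
  have h3 : η • U x + (1 - η) • L x - x = η • (U x - x) + (1 - η) • (L x - x) := by module
  rw [h3, inner_add_left, inner_smul_left, inner_smul_left]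
  simp only [conj_trivial]
  linarith

lemma IsSQNEOn.combination {β γ η ρ : ℝ} (hβ : 0 < β) (hγ : 0 < γ) (hη0 : 0 < η) (hη1 : η < 1)
    (hρ : ρ ≤ (η / (β + 1) + (1 - η) / (γ + 1))⁻¹ - 1) {S : Set H} {U L : H → H}
    (hU : IsSQNEOn β S U) (hL : IsSQNEOn γ S L) :
    IsSQNEOn ρ S (fun y => η • U y + (1 - η) • L y) := by
  intro x z hz
  have h1 := inner_combination_ge hη0.le hη1.le hU hL x hz
  have hζ : 0 < 1 - η := by linarith
  have h2 : ‖η • U x + (1 - η) • L x - x‖ ≤ η * ‖U x - x‖ + (1 - η) * ‖L x - x‖ := by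
    have h3 : η • U x + (1 - η) • L x - x = η • (U x - x) + (1 - η) • (L x - x) := by module
    rw [h3]
    refine (norm_add_le _ _).trans (le_of_eq ?_)
    rw [norm_smul, norm_smul, Real.norm_of_nonneg hη0.le, Real.norm_of_nonneg hζ.le]
  set a := ‖L x - x‖
  set b := ‖U x - x‖
  show (1 + ρ) / 2 * ‖η • U x + (1 - η) • L x - x‖ ^ 2 ≤ _
  refine le_trans ?_ h1
  set w := ‖η • U x + (1 - η) • L x - x‖
  have hw : 0 ≤ w := norm_nonneg _
  generalize 1 - η = ζ at *
  have hB : 0 < β + 1 := by positivity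
  have hG : 0 < γ + 1 := by positivity
  have h3 : w ^ 2 ≤ (η * b + ζ * a) ^ 2 := pow_le_pow_left₀ hw h2 2
  have h4 : (η / (β + 1) + ζ / (γ + 1))⁻¹
      = (β + 1) * (γ + 1) / (η * (γ + 1) + ζ * (β + 1)) := by field_simp
  have hs : 0 < η * (γ + 1) + ζ * (β + 1) := by positivity
  have hρ' : (1 + ρ) * (η * (γ + 1) + ζ * (β + 1)) ≤ (β + 1) * (γ + 1) := by
    rw [← le_div_iff₀ hs, ← h4]; linarith
  have h6 := mul_le_mul hρ' h3 (by positivity) (by positivity)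
  have h7 : (η * (γ + 1) + ζ * (β + 1)) * ((1 + ρ) * w ^ 2) ≤
      (η * (γ + 1) + ζ * (β + 1)) * (η * (β + 1) * b ^ 2 + ζ * (γ + 1) * a ^ 2) := by
    -- Exactly the defect in the weighted Cauchy–Schwarz inequality bounding `(β + 1)(γ + 1)(η b + ζ
    -- a)²`.
    have h8 : 0 ≤ η * ζ * ((β + 1) * b - (γ + 1) * a) ^ 2 := by positivity
    nlinarith
  have h9 := le_of_mul_le_mul_left h7 hs
  linarith

end Cutters

/-! ### The extrapolated Landweber operator -/

section Landweber

variable {H₁ H₂ : Type*} [NormedAddCommGroup H₁] [InnerProductSpace ℝ H₁] [CompleteSpace H₁]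
  [NormedAddCommGroup H₂] [InnerProductSpace ℝ H₂] [CompleteSpace H₂]

lemma inner_landweber_ge {A : H₁ →L[ℝ] H₂} {σ : H₁ → ℝ} {V : H₂ → H₂} {γ : ℝ} {D : Set H₂}
    (hV : IsSQNEOn γ D V) (hσ : ∀ x, 0 ≤ σ x) (x : H₁) {z : H₁} (hz : A z ∈ D) :
    σ x / ‖A‖ ^ 2 * ((1 + γ) / 2 * ‖V (A x) - A x‖ ^ 2)
      ≤ inner ℝ (landweber A σ V x - x) (z - x) := by
  have h : landweber A σ V x - x
      = (σ x / ‖A‖ ^ 2) • (ContinuousLinearMap.adjoint A) (V (A x) - A x) := by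
    simp [landweber]
  rw [h, inner_smul_left, ContinuousLinearMap.adjoint_inner_left, map_sub]
  simp only [conj_trivial]
  exact mul_le_mul_of_nonneg_left (hV (A x) (A z) hz) (div_nonneg (hσ x) (by positivity))

/-- When `V` moves `A x`, the bound on `σ` says precisely that `σ ‖A*(V(Ax) - Ax)‖² ≤ (‖A‖ ‖V(Ax) -
Ax‖)²`. This lets the Landweber operator inherit the constant `γ` of `V`. -/
lemma norm_landweber_sub_sq_le {A : H₁ →L[ℝ] H₂} (hA : A ≠ 0) {σ : H₁ → ℝ} {V : H₂ → H₂}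
    (hσ : ∀ x, 1 ≤ σ x ∧ σ x ≤ extrapolationBound A V x) (x : H₁) :
    ‖landweber A σ V x - x‖ ^ 2 ≤ σ x / ‖A‖ ^ 2 * ‖V (A x) - A x‖ ^ 2 := by
  have hA' : 0 < ‖A‖ := norm_pos_iff.2 hA
  obtain ⟨h1, h2⟩ := hσ x
  have h : landweber A σ V x - x
      = (σ x / ‖A‖ ^ 2) • (ContinuousLinearMap.adjoint A) (V (A x) - A x) := by
    simp [landweber]
  rw [h, norm_smul, mul_pow, Real.norm_eq_abs, sq_abs]
  by_cases hV : V (A x) = A x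
  · simp [hV]
  · rw [extrapolationBound, if_neg hV] at h2
    set g := ‖(ContinuousLinearMap.adjoint A) (V (A x) - A x)‖
    set d := ‖V (A x) - A x‖
    -- If the adjoint kills the residual, division by zero gives the bound the value 0,
    -- contradicting `1 ≤ σ x`.
    by_cases hg : g = 0
    · rw [hg] at h2; norm_num at h2; linarith
    have hg' : 0 < g := lt_of_le_of_ne (norm_nonneg _) (Ne.symm hg)
    rw [div_pow, le_div_iff₀ (by positivity)] at h2
    have e1 : (σ x / ‖A‖ ^ 2) ^ 2 * g ^ 2 = σ x / ‖A‖ ^ 4 * (σ x * g ^ 2) := by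
      field_simp
    have e2 : σ x / ‖A‖ ^ 2 * d ^ 2 = σ x / ‖A‖ ^ 4 * (‖A‖ * d) ^ 2 := by
      field_simp
    rw [e1, e2]
    exact mul_le_mul_of_nonneg_left h2 (by positivity)

lemma isSQNEOn_landweber {A : H₁ →L[ℝ] H₂} (hA : A ≠ 0) {σ : H₁ → ℝ} {V : H₂ → H₂} {γ : ℝ}
    (hγ : 0 ≤ γ) {D : Set H₂} (hV : IsSQNEOn γ D V)
    (hσ : ∀ x, 1 ≤ σ x ∧ σ x ≤ extrapolationBound A V x) :
    IsSQNEOn γ (A ⁻¹' D) (landweber A σ V) := by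
  intro x z hz
  have h1 := inner_landweber_ge hV (fun x => zero_le_one.trans (hσ x).1) x hz
  have h2 := mul_le_mul_of_nonneg_left (norm_landweber_sub_sq_le hA hσ x)
    (by linarith : 0 ≤ (1 + γ) / 2)
  linarith

/-- The converse direction: on bounded sets a small Landweber displacement forces a small
displacement of `V` at `A x`. Only `1 ≤ σ` matters for this, not the upper bound. -/
lemma norm_sub_sq_le_landweber {A : H₁ →L[ℝ] H₂} (hA : A ≠ 0) {σ : H₁ → ℝ} {V : H₂ → H₂}
    {γ : ℝ} (hγ : 0 ≤ γ) {D : Set H₂} (hV : IsSQNEOn γ D V) (hσ : ∀ x, 1 ≤ σ x)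
    (x : H₁) {z : H₁} (hz : A z ∈ D) :
    ‖V (A x) - A x‖ ^ 2 ≤ 2 * ‖A‖ ^ 2 * ‖z - x‖ * ‖landweber A σ V x - x‖ := by
  have hA' : 0 < ‖A‖ := norm_pos_iff.2 hA
  have h1 := (inner_landweber_ge hV (fun x => zero_le_one.trans (hσ x)) x hz).trans
    (real_inner_le_norm _ _)
  rw [div_mul_eq_mul_div, div_le_iff₀ (by positivity)] at h1
  have h2 : ‖V (A x) - A x‖ ^ 2 ≤ 2 * (σ x * ((1 + γ) / 2 * ‖V (A x) - A x‖ ^ 2)) := by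
    have : 1 ≤ σ x * (1 + γ) := by nlinarith [hσ x]
    nlinarith [sq_nonneg ‖V (A x) - A x‖]
  linarith

end Landweber


/-! ### Uniform regularity of operator sequences and its permanence properties -/

section Controls

variable {H : Type*} [NormedAddCommGroup H]

/-- On bounded sets, uniformly in large `k`, a small displacement of `T k` forces the functions
`d i`, `i ∈ K k`, to be small. -/
def Controls {ι : Type*} (T : ℕ → H → H) (d : ι → H → ℝ) (K : ℕ → Set ι) : Prop :=
  ∀ M ε : ℝ, 0 < ε → ∃ δ > 0, ∃ N, ∀ k ≥ N, ∀ x, ‖x‖ ≤ M → ‖T k x - x‖ < δ →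
    ∀ i ∈ K k, d i x < ε

/-- Failure of uniformity provides bad points at arbitrarily late indices, but the regularity
hypothesis speaks of full sequences. A common fixed point fills the gaps. -/
lemma RegularAlong.controls {ι : Type*} [Fintype ι] {U : ℕ → H → H} {C : ι → Set H}
    {I : ℕ → Finset ι} {hI : ∀ k, (I k).Nonempty} (h : RegularAlong U C I hI) {z : H}
    (hz : ∀ k, U k z = z) :
    Controls U (fun i x => Metric.infDist x (C i)) (fun k => (I k : Set ι)) := by
  intro M ε hε
  by_contra! hc
  have hf : ∀ n : ℕ, ∃ᶠ k in atTop, ∃ x, ‖x‖ ≤ M ∧ ‖U k x - x‖ < 1 / ((n : ℝ) + 1) ∧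
      ∃ i ∈ I k, ε ≤ Metric.infDist x (C i) := by
    intro n
    rw [frequently_atTop]
    intro N
    obtain ⟨k, hk, x, h1, h2, i, h3, h4⟩ := hc (1 / ((n : ℝ) + 1)) (by positivity) N
    exact ⟨k, hk, x, h1, h2, i, h3, h4⟩
  obtain ⟨φ, hφ, hx⟩ := extraction_forall_of_frequently hf
  choose x hxM hxU i hi hiε using hx
  -- Off the range of `φ` the value is the fixed point `z`, whose displacement is zero, so the
  -- displacements tend to zero along all indices.
  set y : ℕ → H := Function.extend φ x (fun _ => z) with hy
  have hyφ : ∀ n, y (φ n) = x n := fun n => hφ.injective.extend_apply _ _ _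
  have hyz : ∀ k, (¬ ∃ n, φ n = k) → y k = z := fun k hk => Function.extend_apply' _ _ _ hk
  have hyb : Bornology.IsBounded (range y) := by
    rw [isBounded_iff_forall_norm_le]
    refine ⟨max M ‖z‖, ?_⟩
    rintro _ ⟨k, rfl⟩
    by_cases hk : ∃ n, φ n = k
    · obtain ⟨n, rfl⟩ := hk
      rw [hyφ]
      exact (hxM n).trans (le_max_left _ _)
    · rw [hyz k hk]
      exact le_max_right _ _
  have hyU : Tendsto (fun k => ‖U k (y k) - y k‖) atTop (𝓝 0) := by
    rw [Metric.tendsto_atTop]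
    intro e he
    obtain ⟨n₀, hn₀⟩ := exists_nat_one_div_lt he
    refine ⟨φ n₀, fun k hk => ?_⟩
    rw [dist_zero_right, norm_norm]
    by_cases hk' : ∃ n, φ n = k
    · obtain ⟨n, rfl⟩ := hk'
      rw [hyφ]
      have hn : n₀ ≤ n := hφ.le_iff_le.1 hk
      exact (hxU n).trans_le ((Nat.one_div_le_one_div hn).trans hn₀.le)
    · rw [hyz k hk', hz]
      simpa using he
  have hlim := (h y hyb hyU).comp hφ.tendsto_atTop
  obtain ⟨n, hn⟩ := (hlim.eventually (gt_mem_nhds hε)).exists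
  simp only [Function.comp_apply, Finset.sup'_lt_iff] at hn
  have := hn (i n) (hi n)
  rw [hyφ] at this
  exact absurd this (not_lt.2 (hiε n))

lemma BoundedlyRegular.uniform {ι : Type*} [Fintype ι] [Nonempty ι] {C : ι → Set H}
    (h : BoundedlyRegular C) (M ε : ℝ) (hε : 0 < ε) :
    ∃ δ > 0, ∀ x, ‖x‖ ≤ M → (∀ i, Metric.infDist x (C i) < δ) →
      Metric.infDist x (⋂ i, C i) < ε := by
  by_contra! hc
  choose x hxM hxd hxε using fun n : ℕ => hc (1 / ((n : ℝ) + 1)) (by positivity)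
  have hb : Bornology.IsBounded (range x) := by
    rw [isBounded_iff_forall_norm_le]
    exact ⟨M, by rintro _ ⟨k, rfl⟩; exact hxM k⟩
  have hlim := h x hb (squeeze_zero
    (fun n => (Metric.infDist_nonneg).trans (Finset.le_sup'
      (fun i => Metric.infDist (x n) (C i)) (Finset.mem_univ (Classical.arbitrary ι))))
    (fun n => Finset.sup'_le _ _ fun i _ => (hxd n i).le) tendsto_one_div_add_atTop_nhds_zero_nat)
  obtain ⟨n, hn⟩ := (hlim.eventually (gt_mem_nhds hε)).exists
  exact absurd hn (not_lt.2 (hxε n))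

/-- The arithmetic shared by all the transfer lemmas: `w` is the displacement of the composite
operator, `b` that of a component, and the hypothesis `h` comes from Cauchy–Schwarz against a fixed
`z ∈ S`. -/
lemma lt_of_mul_sq_le {q b w M δ r : ℝ} {x z : H} (hq : 0 < q) (hr : 0 < r)
    (h : q * b ^ 2 ≤ 2 * (w * ‖z - x‖)) (hx : ‖x‖ ≤ M) (hw : 0 ≤ w) (hwδ : w < δ)
    (hδ : 2 * (‖z‖ + M) * δ < q * r ^ 2) : b < r := by
  have h1 : ‖z - x‖ ≤ ‖z‖ + M := (norm_sub_le _ _).trans (by gcongr)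
  have h2 : w * ‖z - x‖ ≤ δ * (‖z‖ + M) :=
    mul_le_mul hwδ.le h1 (norm_nonneg _) (hw.trans hwδ.le)
  have h3 : b ^ 2 < r ^ 2 := lt_of_mul_lt_mul_left (by linarith) hq.le
  exact lt_of_pow_lt_pow_left₀ 2 hr.le h3

variable {ι : Type*} {d : ι → H → ℝ} {K : ℕ → Set ι}

lemma Controls.relax [InnerProductSpace ℝ H] {T : ℕ → H → H} (h : Controls T d K) {ρ : ℕ → ℝ}
    (hρ : ∀ k, 0 ≤ ρ k) :
    Controls (fun k => relax ((1 + ρ k) / 2) (T k)) d K := by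
  intro M ε hε
  obtain ⟨δ, hδ, N, hN⟩ := h M ε hε
  refine ⟨δ / 2, by positivity, N, fun k hk x hx hT => hN k hk x hx ?_⟩
  have := norm_sub_le_relax (hρ k) (T k) x
  linarith

section Compose

variable [InnerProductSpace ℝ H] {S : Set H} {z : H} {U L : ℕ → H → H} {β γ : ℕ → ℝ} {β₀ γ₀ : ℝ}

lemma Controls.comp_left (hz : z ∈ S) (hU : ∀ k, IsSQNEOn (β k) S (U k))
    (hL : ∀ k, IsSQNEOn (γ k) S (L k)) (hβ₀ : 0 < β₀) (hβ : ∀ k, β₀ ≤ β k)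
    (hγ₀ : 0 < γ₀) (hγ : ∀ k, γ₀ ≤ γ k) (h : Controls U d K)
    (hd : ∀ i x y, d i x ≤ d i y + ‖x - y‖) :
    Controls (fun k y => U k (L k y)) d K := by
  intro M ε hε
  obtain ⟨δ, hδ, N, hN⟩ := h (M + 1) (ε / 2) (by positivity)
  -- `U` acts at `L x` rather than at `x`: `δ` triggers the control of `U`, `1` keeps `L x` in the
  -- enlarged ball, and `ε / 2` pays for returning from `L x` to `x`.
  set r := min δ (min 1 (ε / 2)) with hr
  have hr0 : 0 < r := by positivity
  have hrδ : r ≤ δ := min_le_left _ _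
  have hr1 : r ≤ 1 := (min_le_right _ _).trans (min_le_left _ _)
  have hrε : r ≤ ε / 2 := (min_le_right _ _).trans (min_le_right _ _)
  obtain ⟨δ', hδ', hlt⟩ := exists_pos_mul_lt (a := min β₀ γ₀ * r ^ 2) (by positivity)
    (2 * (‖z‖ + M))
  refine ⟨δ', hδ', N, fun k hk x hx hT i hi => ?_⟩
  have h1 := two_inner_comp_ge (hU k) (hL k) x hz
  have h2 := real_inner_le_norm (U k (L k x) - x) (z - x)
  have h3 := mul_le_mul_of_nonneg_right (hβ k) (sq_nonneg ‖U k (L k x) - L k x‖)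
  have h4 := mul_le_mul_of_nonneg_right (hγ k) (sq_nonneg ‖L k x - x‖)
  have h5 := mul_nonneg hβ₀.le (sq_nonneg ‖U k (L k x) - L k x‖)
  have h6 := mul_nonneg hγ₀.le (sq_nonneg ‖L k x - x‖)
  have h7 := sq_nonneg ‖U k (L k x) - x‖
  have hb : ‖U k (L k x) - L k x‖ < r :=
    lt_of_mul_sq_le hβ₀ hr0 (by linarith) hx (norm_nonneg _) hT
      (hlt.trans_le (by gcongr; exact min_le_left _ _))
  have ha : ‖L k x - x‖ < r :=
    lt_of_mul_sq_le hγ₀ hr0 (by linarith) hx (norm_nonneg _) hT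
      (hlt.trans_le (by gcongr; exact min_le_right _ _))
  have hLx : ‖L k x‖ ≤ M + 1 := by
    have := norm_add_le (L k x - x) x
    rw [sub_add_cancel] at this
    linarith
  have h8 := hN k hk (L k x) hLx (hb.trans_le hrδ) i hi
  have h9 := hd i x (L k x)
  rw [norm_sub_rev] at h9
  linarith

lemma Controls.comp_right (hz : z ∈ S) (hU : ∀ k, IsSQNEOn (β k) S (U k))
    (hL : ∀ k, IsSQNEOn (γ k) S (L k)) (hβ : ∀ k, 0 ≤ β k)
    (hγ₀ : 0 < γ₀) (hγ : ∀ k, γ₀ ≤ γ k) (h : Controls L d K) :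
    Controls (fun k y => U k (L k y)) d K := by
  intro M ε hε
  obtain ⟨δ, hδ, N, hN⟩ := h M ε hε
  obtain ⟨δ', hδ', hlt⟩ := exists_pos_mul_lt (a := γ₀ * δ ^ 2) (by positivity) (2 * (‖z‖ + M))
  refine ⟨δ', hδ', N, fun k hk x hx hT => hN k hk x hx ?_⟩
  have h1 := two_inner_comp_ge (hU k) (hL k) x hz
  have h2 := real_inner_le_norm (U k (L k x) - x) (z - x)
  have h4 := mul_le_mul_of_nonneg_right (hγ k) (sq_nonneg ‖L k x - x‖)
  have h5 := mul_nonneg (hβ k) (sq_nonneg ‖U k (L k x) - L k x‖)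
  have h7 := sq_nonneg ‖U k (L k x) - x‖
  exact lt_of_mul_sq_le hγ₀ hδ (by linarith) hx (norm_nonneg _) hT hlt

lemma Controls.combination_left {η : ℕ → ℝ} {η₀ : ℝ} (hz : z ∈ S)
    (hU : ∀ k, IsSQNEOn (β k) S (U k)) (hL : ∀ k, IsSQNEOn (γ k) S (L k))
    (hβ : ∀ k, 0 ≤ β k) (hγ : ∀ k, 0 ≤ γ k) (hη₀ : 0 < η₀) (hη : ∀ k, η₀ ≤ η k)
    (hη1 : ∀ k, η k ≤ 1) (h : Controls U d K) :
    Controls (fun k y => η k • U k y + (1 - η k) • L k y) d K := by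
  intro M ε hε
  obtain ⟨δ, hδ, N, hN⟩ := h M ε hε
  obtain ⟨δ', hδ', hlt⟩ := exists_pos_mul_lt (a := η₀ * δ ^ 2) (by positivity) (2 * (‖z‖ + M))
  refine ⟨δ', hδ', N, fun k hk x hx hT => hN k hk x hx ?_⟩
  have hη' := hη₀.le.trans (hη k)
  have h1 := inner_combination_ge hη' (hη1 k) (hU k) (hL k) x hz
  have h2 := real_inner_le_norm (η k • U k x + (1 - η k) • L k x - x) (z - x)
  have h3 : η₀ * ‖U k x - x‖ ^ 2 ≤ 2 * (η k * ((1 + β k) / 2 * ‖U k x - x‖ ^ 2)) := by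
    have e1 := mul_le_mul_of_nonneg_right (hη k) (sq_nonneg ‖U k x - x‖)
    have e2 := mul_nonneg (mul_nonneg hη' (hβ k)) (sq_nonneg ‖U k x - x‖)
    linarith
  have h4 : 0 ≤ (1 - η k) * ((1 + γ k) / 2 * ‖L k x - x‖ ^ 2) :=
    mul_nonneg (sub_nonneg.2 (hη1 k)) (mul_nonneg (by linarith [hγ k]) (sq_nonneg _))
  exact lt_of_mul_sq_le hη₀ hδ (by linarith) hx (norm_nonneg _) hT hlt

lemma Controls.combination_right {η : ℕ → ℝ} {η₀ : ℝ} (hz : z ∈ S)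
    (hU : ∀ k, IsSQNEOn (β k) S (U k)) (hL : ∀ k, IsSQNEOn (γ k) S (L k))
    (hβ : ∀ k, 0 ≤ β k) (hγ : ∀ k, 0 ≤ γ k) (hη₀ : 0 < η₀) (hη : ∀ k, η k ≤ 1 - η₀)
    (hη0 : ∀ k, 0 ≤ η k) (h : Controls L d K) :
    Controls (fun k y => η k • U k y + (1 - η k) • L k y) d K := by
  have h1 := Controls.combination_left (η := fun k => 1 - η k) hz hL hU hγ hβ hη₀
    (fun k => by linarith [hη k]) (fun k => by linarith [hη0 k]) h
  refine cast (congrArg (fun T => Controls T d K) ?_) h1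
  funext k y
  rw [sub_sub_cancel, add_comm]

end Compose

/-- A `p`-covering control and small steps make all the functions `d i` small. -/
lemma Controls.lt_of_small_steps {T : ℕ → H → H} (h : Controls T d K) {c : ℝ} (hc : 0 ≤ c)
    (hd : ∀ i x y, d i x ≤ d i y + c * ‖x - y‖) {p : ℕ}
    (hK : ∀ k i, ∃ l < p, i ∈ K (k + l)) {u : ℕ → H} {M : ℝ} (hu : ∀ k, ‖u k‖ ≤ M)
    (ε : ℝ) (hε : 0 < ε) :
    ∃ δ > 0, ∃ N, ∀ k ≥ N, (∀ l < p, ‖T (k + l) (u (k + l)) - u (k + l)‖ < δ) →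
      (∀ l < p, ‖u (k + l + 1) - u (k + l)‖ < δ) → ∀ i, d i (u k) < ε := by
  obtain ⟨δ, hδ, N, hN⟩ := h M (ε / 2) (by positivity)
  -- The index `i` may become active only `l < p` steps later; the drift until then changes `d i` by
  -- at most `c * p * δ' < ε / 2`.
  obtain ⟨δ', hδ', hlt⟩ := exists_pos_mul_lt (a := ε / 2) (by positivity) (c * p)
  refine ⟨min δ δ', by positivity, N, fun k hk h1 h2 i => ?_⟩
  obtain ⟨l, hl, hi⟩ := hK k i
  have hdist : ∀ q ≤ p, ‖u k - u (k + q)‖ ≤ q * δ' := by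
    intro q
    induction q with
    | zero => simp
    | succ q ih =>
      intro hq
      have e1 := ih (by omega)
      have e2 := (h2 q (by omega)).le.trans (min_le_right _ _)
      have e3 := norm_sub_le_norm_sub_add_norm_sub (u k) (u (k + q)) (u (k + q + 1))
      rw [norm_sub_rev (u (k + q)) (u (k + q + 1))] at e3
      push_cast
      rw [← add_assoc]
      linarith
  have h3 := hN (k + l) (by omega) (u (k + l)) (hu _) ((h1 l hl).trans_le (min_le_left _ _)) i hi
  have h4 := hd i (u k) (u (k + l))
  have h5 : c * ‖u k - u (k + l)‖ ≤ c * p * δ' := by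
    rw [mul_assoc]
    refine mul_le_mul_of_nonneg_left ((hdist l hl.le).trans ?_) hc
    gcongr
  linarith

/-- Control along an operator sequence of which `T` is a rearrangement on the indices `2 k + r`. -/
lemma Controls.of_two_mul_add {T U : ℕ → H → H} (h : Controls U d K) (r : ℕ) (hr : r < 2)
    (hT : ∀ k x, T (2 * k + r) x = U k x) :
    Controls T d (fun k => {i | k % 2 = r ∧ i ∈ K (k / 2)}) := by
  intro M ε hε
  obtain ⟨δ, hδ, N, hN⟩ := h M ε hε
  refine ⟨δ, hδ, 2 * N, fun k hk x hx hTx i hi => ?_⟩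
  have hk' : 2 * (k / 2) + r = k := by have := hi.1; omega
  have e := hT (k / 2) x
  rw [hk'] at e
  exact hN (k / 2) (by omega) x hx (by rwa [e] at hTx) i hi.2

lemma exists_mem_of_two_mul_add {s : ℕ} (hK : ∀ k i, ∃ l < s, i ∈ K (k + l)) (r : ℕ)
    (hr : r < 2) (k : ℕ) (i : ι) :
    ∃ l < 2 * s + 2, i ∈ {i | (k + l) % 2 = r ∧ i ∈ K ((k + l) / 2)} := by
  obtain ⟨l, hl, hi⟩ := hK ((k + 1) / 2) i
  -- `(k + 1) / 2` is `k / 2` rounded up, so the subtraction in `ℕ` does not truncate.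
  refine ⟨2 * ((k + 1) / 2 + l) + r - k, by omega, ?_⟩
  have e : k + (2 * ((k + 1) / 2 + l) + r - k) = 2 * ((k + 1) / 2 + l) + r := by omega
  rw [mem_ofPred_eq, e]
  refine ⟨by omega, ?_⟩
  have e2 : (2 * ((k + 1) / 2 + l) + r) / 2 = (k + 1) / 2 + l := by omega
  rwa [e2]

end Controls

/-! ### Transfer of regularity through `A`, and closed range -/

section Landweber

variable {H₁ H₂ : Type*} [NormedAddCommGroup H₁] [InnerProductSpace ℝ H₁] [CompleteSpace H₁]
  [NormedAddCommGroup H₂] [InnerProductSpace ℝ H₂] [CompleteSpace H₂]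

lemma Controls.landweber {A : H₁ →L[ℝ] H₂} (hA : A ≠ 0) {σ : ℕ → H₁ → ℝ} {V : ℕ → H₂ → H₂}
    {γ : ℕ → ℝ} (hγ : ∀ k, 0 ≤ γ k) {D : Set H₂} (hV : ∀ k, IsSQNEOn (γ k) D (V k))
    (hσ : ∀ k x, 1 ≤ σ k x) {z : H₁} (hz : A z ∈ D) {ι : Type*} {d : ι → H₂ → ℝ}
    {K : ℕ → Set ι} (h : Controls V d K) :
    Controls (fun k => landweber A (σ k) (V k)) (fun i x => d i (A x)) K := by
  have hA' : 0 < ‖A‖ := norm_pos_iff.2 hA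
  intro M ε hε
  obtain ⟨δ, hδ, N, hN⟩ := h (‖A‖ * M) ε hε
  obtain ⟨δ', hδ', hlt⟩ := exists_pos_mul_lt (a := (‖A‖ ^ 2)⁻¹ * δ ^ 2) (by positivity)
    (2 * (‖z‖ + M))
  refine ⟨δ', hδ', N, fun k hk x hx hT => hN k hk (A x)
    ((A.le_opNorm x).trans (by gcongr)) ?_⟩
  have h1 := norm_sub_sq_le_landweber hA (hγ k) (hV k) (hσ k) x hz
  refine lt_of_mul_sq_le (q := (‖A‖ ^ 2)⁻¹) (x := x) (z := z) (by positivity) hδ ?_ hx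
    (norm_nonneg _) hT hlt
  rw [inv_mul_le_iff₀ (by positivity)]
  linarith

/-- The linear regularity of the preimage under an operator with closed range. -/
lemma exists_infDist_preimage_le {A : H₁ →L[ℝ] H₂} (hA : IsClosed (range A)) {D : Set H₂}
    (hD : (A ⁻¹' D).Nonempty) :
    ∃ κ > 0, ∀ x, Metric.infDist x (A ⁻¹' D) ≤ κ * Metric.infDist (A x) (range A ∩ D) := by
  have : CompleteSpace A.toLinearMap.range := by
    refine IsClosed.completeSpace_coe (s := (A.toLinearMap.range : Set H₂)) (hs := ?_)
    convert hA using 1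
    ext; simp
  -- Open mapping theorem for `A` onto its range, complete because closed. The difference `A y - A
  -- x` thus lifts to some `v` with `‖v‖ ≤ κ ‖A y - A x‖`, and `x + v` lies in the preimage of `D`.
  obtain ⟨κ, hκ, h⟩ := A.rangeRestrict.exists_preimage_norm_le
    (LinearMap.surjective_rangeRestrict A.toLinearMap)
  refine ⟨κ, hκ, fun x => ?_⟩
  obtain ⟨z, hz⟩ := hD
  have hne : (range A ∩ D).Nonempty := ⟨A z, mem_range_self z, hz⟩
  rw [← div_le_iff₀' hκ, Metric.le_infDist hne]
  rintro _ ⟨⟨y, rfl⟩, hy⟩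
  obtain ⟨v, hv, hle⟩ := h (A.rangeRestrict (y - x))
  have hv' : A v = A y - A x := by
    have := congrArg Subtype.val hv
    simpa using this
  have hle' : ‖v‖ ≤ κ * ‖A y - A x‖ := by
    have e : ‖A.rangeRestrict (y - x)‖ = ‖A y - A x‖ := by
      rw [← map_sub]; rfl
    rwa [e] at hle
  rw [div_le_iff₀' hκ, dist_comm, dist_eq_norm]
  have hmem : x + v ∈ A ⁻¹' D := by
    show A (x + v) ∈ D
    rw [map_add, hv', add_sub_cancel]
    exact hy
  refine (Metric.infDist_le_dist_of_mem hmem).trans ?_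
  simpa [dist_eq_norm] using hle'

/-- Since `A x` lies in the range, closeness to all `Q j` gives closeness to `range A ∩ Q`. The
preimage estimate pulls this back to closeness of `x` to `A⁻¹(Q)`, and regularity of the family with
the `C i` finishes. -/
lemma infDist_solutionSet_lt {m n : ℕ} {A : H₁ →L[ℝ] H₂} {C : Fin m → Set H₁}
    {Q : Fin n → Set H₂} (hS : (solutionSet A C Q).Nonempty) (hA : IsClosed (range A))
    (hC : BoundedlyRegular (Fin.cons (A ⁻¹' (⋂ j, Q j)) C : Fin (m + 1) → Set H₁))
    (hQ : BoundedlyRegular (Fin.cons (range A) Q : Fin (n + 1) → Set H₂))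
    (M ε : ℝ) (hε : 0 < ε) :
    ∃ δ > 0, ∀ x, ‖x‖ ≤ M → (∀ i, Metric.infDist x (C i) < δ) →
      (∀ j, Metric.infDist (A x) (Q j) < δ) → Metric.infDist x (solutionSet A C Q) < ε := by
  obtain ⟨z, hz⟩ := hS
  obtain ⟨κ, hκ, hAκ⟩ := exists_infDist_preimage_le hA (D := ⋂ j, Q j) ⟨z, hz.2⟩
  have eC : (⋂ i, (Fin.cons (A ⁻¹' (⋂ j, Q j)) C : Fin (m + 1) → Set H₁) i)
      = solutionSet A C Q := by
    ext x
    rw [mem_iInter, Fin.forall_fin_succ]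
    simp [solutionSet, and_comm]
  have eQ : (⋂ j, (Fin.cons (range A) Q : Fin (n + 1) → Set H₂) j)
      = range A ∩ ⋂ j, Q j := by
    ext x
    rw [mem_iInter, Fin.forall_fin_succ]
    simp
  obtain ⟨δ₁, hδ₁, h₁⟩ := hC.uniform M ε hε
  obtain ⟨δ₂, hδ₂, h₂⟩ := hQ.uniform (‖A‖ * M) (δ₁ / κ) (by positivity)
  rw [eC] at h₁
  rw [eQ] at h₂
  refine ⟨min δ₁ δ₂, by positivity, fun x hx hCx hQx => h₁ x hx ?_⟩
  rw [Fin.forall_fin_succ]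
  refine ⟨?_, fun i => by simpa using (hCx i).trans_le (min_le_left _ _)⟩
  have h3 := h₂ (A x) ((A.le_opNorm x).trans (by gcongr)) (by
    rw [Fin.forall_fin_succ]
    refine ⟨?_, fun j => by simpa using (hQx j).trans_le (min_le_right _ _)⟩
    simpa [Metric.infDist_zero_of_mem (mem_range_self x)] using hδ₂)
  rw [lt_div_iff₀' hκ] at h3
  simpa using (hAκ x).trans_lt h3

end Landweber


/-! ### Two convergence lemmas for real sequences -/

section RealSequences

/-- Descent in steps of length `p`: the decrease `c * e k ^ 2` is perturbed by a null sequence, and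
`t k` is small whenever `p` consecutive decreases are small. -/
lemma tendsto_zero_of_descent {t e r : ℕ → ℝ} {c : ℝ} {p : ℕ} (hc : 0 < c) (hp : 1 ≤ p)
    (ht : ∀ k, 0 ≤ t k) (hr : Tendsto r atTop (𝓝 0))
    (hstep : ∀ k, t (k + 1) ≤ t k + r k - c * e k ^ 2)
    (hreg : ∀ ε > 0, ∃ δ > 0, ∃ N, ∀ k ≥ N, (∀ l < p, e (k + l) < δ) → t k < ε) :
    Tendsto t atTop (𝓝 0) := by
  rw [Metric.tendsto_atTop]
  intro ε' hε'
  obtain ⟨ε, hε, hεε'⟩ : ∃ ε, 0 < ε ∧ ε < ε' := ⟨ε' / 2, by positivity, by linarith⟩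
  obtain ⟨δ, hδ, N₁, hN₁⟩ := hreg (ε / 2) (by positivity)
  set c' := c * δ ^ 2 / 2 with hc'
  have hc'0 : 0 < c' := by positivity
  -- Over one block the perturbation totals less than both `ε / 2` and `c'`. So either `t` starts
  -- below `ε / 2` and stays at most `ε`, or one decrease of at least `c * δ ^ 2 = 2 * c'` leaves a
  -- net drop of at least `c'`.
  obtain ⟨η, hη, hpη⟩ := exists_pos_mul_lt (a := min (ε / 2) c') (by positivity) (p : ℝ)
  obtain ⟨N₂, hN₂⟩ := eventually_atTop.1 (hr.eventually (gt_mem_nhds hη))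
  set N := max N₁ N₂
  have hsum : ∀ k ≥ N, ∀ q, t (k + q) ≤ t k + q * η - ∑ l ∈ Finset.range q, c * e (k + l) ^ 2 := by
    intro k hk q
    induction q with
    | zero => simp
    | succ q ih =>
      have h1 := hstep (k + q)
      have h2 := hN₂ (k + q) (by have := le_max_right N₁ N₂; omega)
      rw [Finset.sum_range_succ, ← add_assoc]
      push_cast
      linarith
  have hblock : ∀ k ≥ N, t (k + p) ≤ max (t k - c') ε := by
    intro k hk
    have h1 := hsum k hk p
    have hnn : ∀ l ∈ Finset.range p, 0 ≤ c * e (k + l) ^ 2 := fun l _ => by positivity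
    by_cases hall : ∀ l < p, e (k + l) < δ
    · have h2 := hN₁ k ((le_max_left _ _).trans hk) hall
      have h3 := Finset.sum_nonneg hnn
      refine le_max_of_le_right ?_
      linarith [min_le_left (ε / 2) c']
    · push Not at hall
      obtain ⟨l, hl, hle⟩ := hall
      have h2 := Finset.single_le_sum hnn (Finset.mem_range.2 hl)
      have h3 : c * δ ^ 2 ≤ c * e (k + l) ^ 2 := by gcongr
      refine le_max_of_le_left ?_
      linarith [min_le_right (ε / 2) c']
  have hiter : ∀ k ≥ N, ∀ j : ℕ, t (k + j * p) ≤ max (t k - j * c') ε := by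
    intro k hk j
    induction j with
    | zero => simp
    | succ j ih =>
      have h1 := hblock (k + j * p) (by omega)
      rw [Nat.succ_mul, ← add_assoc]
      refine h1.trans (max_le ?_ (le_max_right _ _))
      rcases le_max_iff.1 ih with h | h
      · refine le_max_of_le_left ?_
        push_cast
        linarith
      · refine le_max_of_le_right ?_
        linarith
  -- Every late index lies on one of `p` progressions of step `p`; `B` dominates all their starting
  -- values.
  set B := ∑ q ∈ Finset.range p, t (N + q) with hB
  obtain ⟨j₀, hj₀⟩ := exists_nat_gt (B / c')
  rw [div_lt_iff₀ hc'0] at hj₀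
  refine ⟨N + j₀ * p, fun k hk => ?_⟩
  rw [Real.dist_eq, sub_zero, abs_of_nonneg (ht k)]
  have hkN : N ≤ k := (Nat.le_add_right _ _).trans hk
  have hmod : (k - N) % p < p := Nat.mod_lt _ hp
  have hj : j₀ ≤ (k - N) / p := (Nat.le_div_iff_mul_le hp).2 (by omega)
  have hk' : N + (k - N) % p + (k - N) / p * p = k := by
    have := Nat.mod_add_div' (k - N) p
    omega
  have h1 := hiter (N + (k - N) % p) (by omega) ((k - N) / p)
  rw [hk'] at h1
  have h2 : t (N + (k - N) % p) ≤ B :=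
    Finset.single_le_sum (f := fun q => t (N + q)) (fun q _ => ht _) (Finset.mem_range.2 hmod)
  have h3 : (j₀ : ℝ) * c' ≤ ((k - N) / p : ℕ) * c' := by gcongr
  refine (h1.trans (max_le ?_ le_rfl)).trans_lt hεε'
  linarith

/-- Once `b k < α * ε`, the perturbation is absorbed by the level `ε`: the excess `max (s k - ε) 0`
contracts by `1 - lam k * α ≤ exp (-α * lam k)`, and the product of these factors vanishes because
the sum diverges. -/
lemma tendsto_zero_of_le_one_sub_mul {s lam b : ℕ → ℝ} {α : ℝ} (hα : 0 < α)
    (hs : ∀ k, 0 ≤ s k) (hlam : ∀ k, 0 ≤ lam k) (hb : Tendsto b atTop (𝓝 0))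
    (h1 : ∀ᶠ k in atTop, lam k * α ≤ 1)
    (hstep : ∀ᶠ k in atTop, s (k + 1) ≤ (1 - lam k * α) * s k + lam k * b k)
    (hsum : Tendsto (fun N => ∑ k ∈ Finset.range N, lam k) atTop atTop) :
    Tendsto s atTop (𝓝 0) := by
  rw [Metric.tendsto_atTop]
  intro ε' hε'
  obtain ⟨ε, hε, hεε'⟩ : ∃ ε, 0 < ε ∧ 2 * ε ≤ ε' := ⟨ε' / 2, by positivity, by linarith⟩
  obtain ⟨N, hN⟩ := eventually_atTop.1
    ((h1.and hstep).and (hb.eventually (gt_mem_nhds (by positivity : 0 < α * ε))))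
  set P : ℕ → ℝ := fun k => ∑ i ∈ Finset.range k, lam i with hP
  set w : ℕ → ℝ := fun k => max (s k - ε) 0 with hw
  have hw0 : ∀ k, 0 ≤ w k := fun k => le_max_right _ _
  have hbound : ∀ k ≥ N, w k ≤ w N * Real.exp (-α * (P k - P N)) := by
    intro k hk
    induction k, hk using Nat.le_induction with
    | base => simp
    | succ k hk ih =>
      obtain ⟨⟨e1, e2⟩, e3⟩ := hN k hk
      have e4 : w (k + 1) ≤ (1 - lam k * α) * w k := by
        refine max_le ?_ (mul_nonneg (by linarith) (hw0 k))
        have e5 : (1 - lam k * α) * (s k - ε) ≤ (1 - lam k * α) * w k :=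
          mul_le_mul_of_nonneg_left (le_max_left _ _) (by linarith)
        have e6 := mul_le_mul_of_nonneg_left e3.le (hlam k)
        linarith
      have e7 : 1 - lam k * α ≤ Real.exp (-α * lam k) := by
        have := Real.add_one_le_exp (-α * lam k)
        linarith
      have e8 : P (k + 1) = P k + lam k := Finset.sum_range_succ _ _
      calc w (k + 1) ≤ (1 - lam k * α) * w k := e4
        _ ≤ Real.exp (-α * lam k) * (w N * Real.exp (-α * (P k - P N))) :=
          mul_le_mul e7 ih (hw0 k) (Real.exp_pos _).le
        _ = w N * Real.exp (-α * (P (k + 1) - P N)) := by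
          rw [mul_left_comm, ← Real.exp_add, e8]
          ring_nf
  have hlim : Tendsto (fun k => w N * Real.exp (-α * (P k - P N))) atTop (𝓝 0) := by
    rw [← mul_zero (w N)]
    refine Tendsto.const_mul _ (Real.tendsto_exp_atBot.comp ?_)
    exact (tendsto_atTop_add_const_right atTop (-P N) hsum).const_mul_atTop_of_neg
      (by linarith : -α < 0)
  obtain ⟨N', hN'⟩ := eventually_atTop.1 (hlim.eventually (gt_mem_nhds hε))
  refine ⟨max N N', fun k hk => ?_⟩
  rw [Real.dist_eq, sub_zero, abs_of_nonneg (hs k)]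
  have h2 := hbound k ((le_max_left _ _).trans hk)
  have h3 := hN' k ((le_max_right _ _).trans hk)
  have h4 : s k - ε ≤ w k := le_max_left _ _
  linarith

end RealSequences

/-! ### Metric projections and the separating half-spaces -/

section Projection

variable {H : Type*} [NormedAddCommGroup H] [InnerProductSpace ℝ H] [CompleteSpace H] {S : Set H}

lemma metricProj_spec (hne : S.Nonempty) (hcl : IsClosed S) (hcv : Convex ℝ S) (x : H) :
    metricProj S x ∈ S ∧ ∀ z ∈ S, ‖x - metricProj S x‖ ≤ ‖x - z‖ := by
  obtain ⟨p, hp, he⟩ := exists_norm_eq_iInf_of_complete_convex hne hcl.isComplete hcv x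
  have h : ∃ p ∈ S, ∀ z ∈ S, ‖x - p‖ ≤ ‖x - z‖ := by
    refine ⟨p, hp, fun z hz => ?_⟩
    rw [he]
    exact ciInf_le ⟨0, by rintro _ ⟨w, rfl⟩; exact norm_nonneg _⟩ (⟨z, hz⟩ : S)
  rw [metricProj, dif_pos h]
  exact h.choose_spec

lemma norm_sub_metricProj (hne : S.Nonempty) (hcl : IsClosed S) (hcv : Convex ℝ S) (x : H) :
    ‖x - metricProj S x‖ = Metric.infDist x S := by
  obtain ⟨h1, h2⟩ := metricProj_spec hne hcl hcv x
  refine le_antisymm ((Metric.le_infDist hne).2 fun z hz => ?_) ?_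
  · rw [dist_eq_norm]
    exact h2 z hz
  · rw [← dist_eq_norm]
    exact Metric.infDist_le_dist_of_mem h1

lemma inner_metricProj_le (hne : S.Nonempty) (hcl : IsClosed S) (hcv : Convex ℝ S) (x : H) {z : H}
    (hz : z ∈ S) : inner ℝ (x - metricProj S x) (z - metricProj S x) ≤ 0 := by
  obtain ⟨h1, h2⟩ := metricProj_spec hne hcl hcv x
  refine (norm_eq_iInf_iff_real_inner_le_zero hcv h1).1 ?_ z hz
  have : Nonempty S := ⟨⟨z, hz⟩⟩
  exact le_antisymm (le_ciInf fun w => h2 w w.2)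
    (ciInf_le ⟨0, by rintro _ ⟨w, rfl⟩; exact norm_nonneg _⟩ (⟨_, h1⟩ : S))

lemma norm_metricProj_sub_le (hne : S.Nonempty) (hcl : IsClosed S) (hcv : Convex ℝ S) (x y : H) :
    ‖metricProj S x - metricProj S y‖ ≤ ‖x - y‖ := by
  have h1 := inner_metricProj_le hne hcl hcv x (metricProj_spec hne hcl hcv y).1
  have h2 := inner_metricProj_le hne hcl hcv y (metricProj_spec hne hcl hcv x).1
  set p := metricProj S x
  set q := metricProj S y
  have h3 : ‖p - q‖ ^ 2 ≤ ‖x - y‖ * ‖p - q‖ := by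
    refine le_trans ?_ (real_inner_le_norm (x - y) (p - q))
    have e : inner ℝ (x - y) (p - q)
        = ‖p - q‖ ^ 2 - inner ℝ (x - p) (q - p) - inner ℝ (y - q) (p - q) := by
      rw [← real_inner_self_eq_norm_sq]
      simp only [inner_sub_left, inner_sub_right]
      ring
    linarith
  rcases (norm_nonneg (p - q)).eq_or_lt with h | h
  · rw [← h]
    exact norm_nonneg _
  · exact le_of_mul_le_mul_right (by linarith) h

lemma norm_relax_metricProj_sub_sq_le (hcl : IsClosed S) (hcv : Convex ℝ S) {a : ℝ} (ha : 0 ≤ a)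
    (v : H) {z : H} (hz : z ∈ S) :
    ‖relax a (metricProj S) v - z‖ ^ 2
      ≤ ‖v - z‖ ^ 2 - a * (2 - a) * ‖metricProj S v - v‖ ^ 2 := by
  have h1 := inner_metricProj_le ⟨z, hz⟩ hcl hcv v hz
  rw [norm_sub_sq_expand _ v z, relax_sub, norm_smul, inner_smul_left, mul_pow, Real.norm_eq_abs,
    sq_abs]
  simp only [conj_trivial]
  set p := metricProj S v
  have e : inner ℝ (p - v) (z - v) = ‖p - v‖ ^ 2 - inner ℝ (v - p) (z - p) := by
    rw [← real_inner_self_eq_norm_sq]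
    simp only [inner_sub_left, inner_sub_right]
    ring
  have h2 : a * ‖p - v‖ ^ 2 ≤ a * inner ℝ (p - v) (z - v) :=
    mul_le_mul_of_nonneg_left (by linarith) ha
  linarith

omit [CompleteSpace H] in
lemma isClosed_halfSpace (x x' : H) : IsClosed (halfSpace x x') := by
  have : Continuous fun z : H => inner ℝ (x - x') (z - x') := by fun_prop
  exact isClosed_le this continuous_const

omit [CompleteSpace H] in
lemma convex_halfSpace (x x' : H) : Convex ℝ (halfSpace x x') := by
  intro y hy z hz s t hs ht hst
  have e : s • y + t • z - x' = s • (y - x') + t • (z - x') := by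
    have : x' = (s + t) • x' := by rw [hst, one_smul]
    nth_rewrite 1 [this]
    module
  show inner ℝ (x - x') (s • y + t • z - x') ≤ 0
  rw [e, inner_add_right, inner_smul_right, inner_smul_right]
  have h1 := mul_nonpos_of_nonneg_of_nonpos hs hy
  have h2 := mul_nonpos_of_nonneg_of_nonpos ht hz
  linarith

-- `x'` is the point of the half-space nearest to `x`. Hence the distance from `u k` to the
-- half-space measures the displacement of `T k`.
omit [CompleteSpace H] in
lemma norm_sub_le_of_mem_halfSpace {x x' p : H} (hp : p ∈ halfSpace x x') :
    ‖x' - x‖ ≤ ‖p - x‖ := by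
  have h1 : inner ℝ (x - x') (p - x') ≤ 0 := hp
  have h2 : ‖x - x'‖ ^ 2 ≤ ‖x - x'‖ * ‖x - p‖ := by
    refine le_trans ?_ (real_inner_le_norm (x - x') (x - p))
    have e : inner ℝ (x - x') (x - p) = ‖x - x'‖ ^ 2 - inner ℝ (x - x') (p - x') := by
      rw [← real_inner_self_eq_norm_sq]
      simp only [inner_sub_left, inner_sub_right]
      ring
    linarith
  rw [norm_sub_rev, norm_sub_rev p x]
  rcases (norm_nonneg (x - x')).eq_or_lt with h | h
  · rw [← h]
    exact norm_nonneg _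
  · exact le_of_mul_le_mul_left (by linarith) h

omit [CompleteSpace H] in
lemma IsSQNEOn.subset_halfSpace {T : H → H} (h : IsSQNEOn 1 S T) (x : H) :
    S ⊆ halfSpace x (T x) := by
  intro z hz
  have h1 := h x z hz
  show inner ℝ (x - T x) (z - T x) ≤ 0
  have e : inner ℝ (x - T x) (z - T x) = ‖T x - x‖ ^ 2 - inner ℝ (T x - x) (z - x) := by
    rw [← real_inner_self_eq_norm_sq]
    simp only [inner_sub_left, inner_sub_right]
    ring
  linarith

end Projection

/-! ### Gradient steps and solvability of the variational inequality -/

section VariationalInequality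

variable {H : Type*} [NormedAddCommGroup H] [InnerProductSpace ℝ H] {S : Set H} {F : H → H}
  {L : ℝ≥0} {α : ℝ}

/-- Expanding gives the factor `1 - 2μα + μ²L²`, and the step-size condition absorbs `μ²L²` into
`μα`. -/
lemma norm_gradient_step_sub_sq_le (hL : LipschitzWith L F) (hα : IsStronglyMonotone α F) {μ : ℝ}
    (hμ : 0 ≤ μ) (hμL : μ * (L : ℝ) ^ 2 ≤ α) (x z : H) :
    ‖(x - μ • F x) - (z - μ • F z)‖ ^ 2 ≤ (1 - μ * α) * ‖x - z‖ ^ 2 := by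
  have h1 := hα.2 x z
  have h2 : ‖F x - F z‖ ^ 2 ≤ (L : ℝ) ^ 2 * ‖x - z‖ ^ 2 := by
    rw [← mul_pow]
    refine pow_le_pow_left₀ (norm_nonneg _) ?_ 2
    simpa [dist_eq_norm] using hL.dist_le_mul x z
  have e : (x - μ • F x) - (z - μ • F z) = (x - z) - μ • (F x - F z) := by module
  rw [e, norm_sub_sq_real, inner_smul_right, norm_smul, mul_pow, Real.norm_eq_abs, sq_abs,
    real_inner_comm]
  have h3 := mul_le_mul_of_nonneg_left h1 hμ
  have h4 := mul_le_mul_of_nonneg_left h2 (sq_nonneg μ)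
  have h5 := mul_le_mul_of_nonneg_right hμL (mul_nonneg hμ (sq_nonneg ‖x - z‖))
  linarith

lemma norm_gradient_step_sub_le (hL : LipschitzWith L F) (hα : IsStronglyMonotone α F) {μ : ℝ}
    (hμ : 0 ≤ μ) (hμL : μ * (L : ℝ) ^ 2 ≤ α) (hμα : μ * α ≤ 1) (x z : H) :
    ‖(x - μ • F x) - (z - μ • F z)‖ ≤ (1 - μ * α / 2) * ‖x - z‖ := by
  refine le_of_abs_le (abs_le_of_sq_le_sq ?_ (mul_nonneg (by linarith) (norm_nonneg _)))
  refine (norm_gradient_step_sub_sq_le hL hα hμ hμL x z).trans ?_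
  rw [mul_pow]
  gcongr
  nlinarith [sq_nonneg (μ * α)]

lemma IsVISolution.eq (hα : IsStronglyMonotone α F) {x y : H} (hx : IsVISolution F S x)
    (hy : IsVISolution F S y) : y = x := by
  have h1 := hx.2 y hy.1
  have h2 := hy.2 x hx.1
  have h3 := hα.2 y x
  have e : inner ℝ (F y - F x) (y - x) = - inner ℝ (F y) (x - y) - inner ℝ (F x) (y - x) := by
    simp only [inner_sub_left, inner_sub_right]
    ring
  have h4 : ‖y - x‖ ^ 2 ≤ 0 := by
    have := hα.1
    by_contra! hc
    have := mul_pos this hc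
    linarith
  have h5 : ‖y - x‖ = 0 := by nlinarith [norm_nonneg (y - x)]
  exact sub_eq_zero.1 (norm_eq_zero.1 h5)

/-- A solution is a fixed point of `x ↦ P_S(x - μ F x)`, a contraction for small `μ > 0` because
`P_S` is nonexpansive. -/
lemma exists_isVISolution [CompleteSpace H] (hne : S.Nonempty) (hcl : IsClosed S)
    (hcv : Convex ℝ S) (hL : LipschitzWith L F) (hα : IsStronglyMonotone α F) :
    ∃ x, IsVISolution F S x := by
  have hα0 := hα.1
  -- The `+ 1` covers the case `L = 0`.
  set μ := min (α / ((L : ℝ) ^ 2 + 1)) (1 / α) with hμ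
  have hμ0 : 0 < μ := by positivity
  have hμα : μ * α ≤ 1 := by
    rw [← le_div_iff₀ hα0]
    exact min_le_right _ _
  have hμL : μ * (L : ℝ) ^ 2 ≤ α := by
    have h1 : μ * ((L : ℝ) ^ 2 + 1) ≤ α := by
      rw [← le_div_iff₀ (by positivity)]
      exact min_le_left _ _
    linarith
  have hμα0 := mul_pos hμ0 hα0
  set g : H → H := fun x => metricProj S (x - μ • F x) with hg
  have hcontr : ContractingWith (1 - μ * α / 2).toNNReal g := by
    refine ⟨?_, LipschitzWith.of_dist_le_mul fun x y => ?_⟩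
    · rw [Real.toNNReal_lt_one]
      linarith
    · rw [dist_eq_norm, dist_eq_norm, Real.coe_toNNReal _ (by linarith)]
      exact (norm_metricProj_sub_le hne hcl hcv _ _).trans
        (norm_gradient_step_sub_le hL hα hμ0.le hμL hμα x y)
  have : Nonempty H := hne.nonempty
  set x := ContractingWith.fixedPoint g hcontr
  have hx : metricProj S (x - μ • F x) = x := hcontr.fixedPoint_isFixedPt
  refine ⟨x, ?_, fun z hz => ?_⟩
  · rw [← hx]
    exact (metricProj_spec hne hcl hcv _).1
  · have h1 := inner_metricProj_le ⟨z, hz⟩ hcl hcv (x - μ • F x) hz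
    rw [hx, sub_sub_cancel_left, inner_neg_left, inner_smul_left] at h1
    simp only [conj_trivial] at h1
    by_contra! hc
    have := mul_neg_of_pos_of_neg hμ0 hc
    linarith

end VariationalInequality

/-! ### Convergence of the outer approximation method -/

section OuterApproximation

variable {H : Type*} [NormedAddCommGroup H] [InnerProductSpace ℝ H] [CompleteSpace H]
  {S : Set H} {F : H → H} {L : ℝ≥0} {α : ℝ} {T : ℕ → H → H} {a lam : ℕ → ℝ} {u : ℕ → H}

lemma IsOuterApproximation.norm_sub_sq_le (hu : IsOuterApproximation F T a lam u)
    (hT : ∀ k, IsSQNEOn 1 S (T k)) {ε : ℝ} (hε : 0 < ε) (ha : ∀ k, ε ≤ a k ∧ a k ≤ 2 - ε) (k : ℕ)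
    {z : H} (hz : z ∈ S) :
    ‖u (k + 1) - z‖ ^ 2 ≤ ‖u k - lam k • F (u k) - z‖ ^ 2
      - ε ^ 2 * ‖metricProj (halfSpace (u k) (T k (u k))) (u k - lam k • F (u k))
          - (u k - lam k • F (u k))‖ ^ 2 := by
  obtain ⟨h1, h2⟩ := ha k
  rw [hu k]
  refine (norm_relax_metricProj_sub_sq_le (isClosed_halfSpace _ _) (convex_halfSpace _ _)
    (hε.le.trans h1) _ ((hT k).subset_halfSpace _ hz)).trans ?_
  have h3 : ε ^ 2 ≤ a k * (2 - a k) := by nlinarith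
  gcongr

lemma IsOuterApproximation.exists_norm_le (hu : IsOuterApproximation F T a lam u)
    (hT : ∀ k, IsSQNEOn 1 S (T k)) (hne : S.Nonempty) {ε : ℝ} (hε : 0 < ε)
    (ha : ∀ k, ε ≤ a k ∧ a k ≤ 2 - ε) (hL : LipschitzWith L F) (hα : IsStronglyMonotone α F)
    (hlam : ∀ k, 0 ≤ lam k)
    (h1 : ∀ᶠ k in atTop, lam k * (L : ℝ) ^ 2 ≤ α ∧ lam k * α ≤ 1) :
    ∃ M, ∀ k, ‖u k‖ ≤ M := by
  obtain ⟨z, hz⟩ := hne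
  have hα0 := hα.1
  obtain ⟨N, hN⟩ := eventually_atTop.1 h1
  -- The ball of radius `B` about `z` is invariant: on its boundary the contraction gains `lam k * α
  -- / 2 * B`, which covers the drift `lam k * ‖F z‖`.
  set B := max ‖u N - z‖ (2 * ‖F z‖ / α) with hB
  have hB0 : 0 ≤ B := (norm_nonneg _).trans (le_max_left _ _)
  have hFz : ‖F z‖ ≤ α / 2 * B := by
    have : 2 * ‖F z‖ / α ≤ B := le_max_right _ _
    rw [div_le_iff₀ hα0] at this
    linarith
  have hbound : ∀ k ≥ N, ‖u k - z‖ ≤ B := by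
    intro k hk
    induction k, hk using Nat.le_induction with
    | base => exact le_max_left _ _
    | succ k hk ih =>
      obtain ⟨e1, e2⟩ := hN k hk
      have e3 := hu.norm_sub_sq_le hT hε ha k hz
      have e4 : ‖u (k + 1) - z‖ ≤ ‖u k - lam k • F (u k) - z‖ :=
        le_of_abs_le
          (abs_le_of_sq_le_sq (e3.trans (sub_le_self _ (by positivity))) (norm_nonneg _))
      have e5 := norm_gradient_step_sub_le hL hα (hlam k) e1 e2 (u k) z
      have e6 : u k - lam k • F (u k) - z
          = ((u k - lam k • F (u k)) - (z - lam k • F z)) - lam k • F z := by abel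
      have e7 : ‖u k - lam k • F (u k) - z‖ ≤ (1 - lam k * α / 2) * ‖u k - z‖ + lam k * ‖F z‖ := by
        rw [e6]
        refine (norm_sub_le _ _).trans (add_le_add e5 ?_)
        rw [norm_smul, Real.norm_of_nonneg (hlam k)]
      have e8 : (1 - lam k * α / 2) * ‖u k - z‖ ≤ (1 - lam k * α / 2) * B :=
        mul_le_mul_of_nonneg_left ih (by linarith)
      have e9 := mul_le_mul_of_nonneg_left hFz (hlam k)
      linarith
  refine ⟨∑ j ∈ Finset.range N, ‖u j‖ + (B + ‖z‖), fun k => ?_⟩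
  have hs : 0 ≤ ∑ j ∈ Finset.range N, ‖u j‖ := Finset.sum_nonneg fun _ _ => norm_nonneg _
  rcases lt_or_ge k N with hk | hk
  · have := Finset.single_le_sum (f := fun j => ‖u j‖) (fun _ _ => norm_nonneg _)
      (Finset.mem_range.2 hk)
    have hz0 := norm_nonneg z
    linarith
  · have e1 := hbound k hk
    have e2 := norm_add_le (u k - z) z
    rw [sub_add_cancel] at e2
    linarith

/-- The distances to `S` tend to zero, if `S` is close to any point of a string of `p` consecutive
iterates with small displacements and small steps. -/
lemma IsOuterApproximation.tendsto_infDist (hu : IsOuterApproximation F T a lam u)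
    (hT : ∀ k, IsSQNEOn 1 S (T k)) (hne : S.Nonempty) (hcl : IsClosed S) (hcv : Convex ℝ S)
    {ε : ℝ} (hε : 0 < ε) (ha : ∀ k, ε ≤ a k ∧ a k ≤ 2 - ε) (hlam : ∀ k, 0 ≤ lam k)
    (hlam0 : Tendsto lam atTop (𝓝 0)) {M G : ℝ} (hM : ∀ k, ‖u k‖ ≤ M) (hG : ∀ k, ‖F (u k)‖ ≤ G)
    {p : ℕ} (hp : 1 ≤ p)
    (hreg : ∀ ε > 0, ∃ δ > 0, ∃ N, ∀ k ≥ N,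
      (∀ l < p, ‖T (k + l) (u (k + l)) - u (k + l)‖ < δ) →
      (∀ l < p, ‖u (k + l + 1) - u (k + l)‖ < δ) → Metric.infDist (u k) S < ε) :
    Tendsto (fun k => Metric.infDist (u k) S) atTop (𝓝 0) := by
  have hG0 : 0 ≤ G := (norm_nonneg _).trans (hG 0)
  have hlamG : ∀ k, ‖lam k • F (u k)‖ ≤ lam k * G := fun k => by
    rw [norm_smul, Real.norm_of_nonneg (hlam k)]
    exact mul_le_mul_of_nonneg_left (hG k) (hlam k)
  obtain ⟨z, hz⟩ := id hne
  set D : ℕ → ℝ := fun k => Metric.infDist (u k) S with hD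
  have hD0 : ∀ k, 0 ≤ D k := fun k => Metric.infDist_nonneg
  have hDM : ∀ k, D k ≤ M + ‖z‖ := fun k => by
    refine (Metric.infDist_le_dist_of_mem hz).trans ?_
    rw [dist_eq_norm]
    exact (norm_sub_le _ _).trans (add_le_add (hM k) le_rfl)
  set v : ℕ → H := fun k => u k - lam k • F (u k) with hv
  set P : ℕ → H := fun k => metricProj (halfSpace (u k) (T k (u k))) (v k) with hP
  set e : ℕ → ℝ := fun k => ‖P k - v k‖ with he
  have huv : ∀ k, ‖v k - u k‖ ≤ lam k * G := fun k => by
    rw [hv, sub_sub_cancel_left, norm_neg]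
    exact hlamG k
  set r : ℕ → ℝ := fun k => lam k * (2 * (M + ‖z‖) * G + lam k * G ^ 2) with hr
  have hr0 : Tendsto r atTop (𝓝 0) := by
    have := hlam0.mul ((hlam0.mul_const (G ^ 2)).const_add (2 * (M + ‖z‖) * G))
    simpa using this
  have hstep : ∀ k, D (k + 1) ^ 2 ≤ D k ^ 2 + r k - ε ^ 2 * e k ^ 2 := by
    intro k
    have hq := (metricProj_spec hne hcl hcv (u k)).1
    set q := metricProj S (u k)
    have hqD : ‖u k - q‖ = D k := norm_sub_metricProj hne hcl hcv (u k)
    have e1 := hu.norm_sub_sq_le hT hε ha k hq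
    have e2 : D (k + 1) ≤ ‖u (k + 1) - q‖ := by
      rw [← dist_eq_norm]
      exact Metric.infDist_le_dist_of_mem hq
    have e3 : D (k + 1) ^ 2 ≤ ‖u (k + 1) - q‖ ^ 2 := pow_le_pow_left₀ (hD0 _) e2 2
    have e4 : ‖v k - q‖ ≤ D k + lam k * G := by
      have := norm_add_le (v k - u k) (u k - q)
      rw [sub_add_sub_cancel, hqD] at this
      linarith [huv k]
    have e5 : ‖v k - q‖ ^ 2 ≤ (D k + lam k * G) ^ 2 := pow_le_pow_left₀ (norm_nonneg _) e4 2
    have e6 : D k * (2 * (lam k * G)) ≤ (M + ‖z‖) * (2 * (lam k * G)) :=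
      mul_le_mul_of_nonneg_right (hDM k) (by have := hlam k; positivity)
    have e7 : (D k + lam k * G) ^ 2 ≤ D k ^ 2 + r k := by
      simp only [hr]
      linarith
    linarith
  -- `P k` lies in the half-space, so it is at least as far from `u k` as `T k (u k)` is.
  have hTe : ∀ k, ‖T k (u k) - u k‖ ≤ e k + lam k * G := by
    intro k
    have hne' : (halfSpace (u k) (T k (u k))).Nonempty := ⟨z, (hT k).subset_halfSpace _ hz⟩
    have e1 := norm_sub_le_of_mem_halfSpace
      (metricProj_spec hne' (isClosed_halfSpace _ _) (convex_halfSpace _ _) (v k)).1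
    have e2 := norm_add_le (P k - v k) (v k - u k)
    rw [sub_add_sub_cancel] at e2
    linarith [huv k]
  have hue : ∀ k, ‖u (k + 1) - u k‖ ≤ 2 * e k + lam k * G := by
    intro k
    have e1 : u (k + 1) - u k = a k • (P k - v k) + (v k - u k) := by
      rw [hu k, SplitVI.relax]
      simp only [hP, hv]
      abel
    rw [e1]
    refine (norm_add_le _ _).trans (add_le_add ?_ (huv k))
    rw [norm_smul, Real.norm_of_nonneg (hε.le.trans (ha k).1)]
    exact mul_le_mul_of_nonneg_right (by linarith [(ha k).2]) (norm_nonneg _)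
  have hsq : Tendsto (fun k => D k ^ 2) atTop (𝓝 0) := by
    refine tendsto_zero_of_descent (by positivity : 0 < ε ^ 2) hp (fun k => sq_nonneg _) hr0 hstep
      fun ε' hε' => ?_
    -- The descent concerns the squared distance, hence the root. The threshold `δ / 4` below fits
    -- the larger bound `2 * e + lam * G < δ`.
    obtain ⟨δ, hδ, N, hN⟩ := hreg (Real.sqrt ε') (Real.sqrt_pos.2 hε')
    have hlG : Tendsto (fun k => lam k * G) atTop (𝓝 0) := by simpa using hlam0.mul_const G
    obtain ⟨N', hN'⟩ := eventually_atTop.1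
      (hlG.eventually (gt_mem_nhds (by positivity : 0 < δ / 2)))
    refine ⟨δ / 4, by positivity, max N N', fun k hk hsmall => ?_⟩
    have hl : ∀ l, lam (k + l) * G < δ / 2 := fun l =>
      hN' _ (by have := le_max_right N N'; omega)
    have hDk := hN k ((le_max_left _ _).trans hk)
      (fun l hl' => by linarith [hTe (k + l), hl l, hsmall l hl'])
      (fun l hl' => by linarith [hue (k + l), hl l, hsmall l hl'])
    exact (Real.lt_sqrt (hD0 k)).1 hDk
  have := hsq.sqrt
  simpa [Real.sqrt_sq (hD0 _)] using this

/-- The iterates need not lie in `S`, so the variational inequality is applied to `q = P_S(u k)`.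
The errors `u k - q` and `lam k • F (u k)` vanish, so the cross term `⟨F x, v - x⟩` is bounded below
by a null sequence. -/
lemma IsOuterApproximation.tendsto_of_tendsto_infDist (hu : IsOuterApproximation F T a lam u)
    (hT : ∀ k, IsSQNEOn 1 S (T k)) (hcl : IsClosed S) (hcv : Convex ℝ S)
    {ε : ℝ} (hε : 0 < ε) (ha : ∀ k, ε ≤ a k ∧ a k ≤ 2 - ε) (hL : LipschitzWith L F)
    (hα : IsStronglyMonotone α F) (hlam : ∀ k, 0 ≤ lam k)
    (h1 : ∀ᶠ k in atTop, lam k * (L : ℝ) ^ 2 ≤ α ∧ lam k * α ≤ 1)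
    (hlam0 : Tendsto lam atTop (𝓝 0)) {G : ℝ} (hG : ∀ k, ‖F (u k)‖ ≤ G)
    (hD : Tendsto (fun k => Metric.infDist (u k) S) atTop (𝓝 0))
    (hsum : Tendsto (fun N => ∑ k ∈ Finset.range N, lam k) atTop atTop) {x : H}
    (hx : IsVISolution F S x) : Tendsto u atTop (𝓝 x) := by
  have hb : Tendsto (fun k => 2 * ‖F x‖ * (Metric.infDist (u k) S + lam k * G)) atTop (𝓝 0) := by
    have := (hD.add (hlam0.mul_const G)).const_mul (2 * ‖F x‖)
    simpa using this
  have hs : Tendsto (fun k => ‖u k - x‖ ^ 2) atTop (𝓝 0) := by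
    refine tendsto_zero_of_le_one_sub_mul hα.1 (fun k => sq_nonneg _) hlam hb
      (h1.mono fun k hk => hk.2) (h1.mono fun k hk => ?_) hsum
    have e1 := hu.norm_sub_sq_le hT hε ha k hx.1
    have e2 := norm_gradient_step_sub_sq_le hL hα (hlam k) hk.1 (u k) x
    set v := u k - lam k • F (u k) with hv
    have hq := metricProj_spec ⟨x, hx.1⟩ hcl hcv (u k)
    have hqD := norm_sub_metricProj ⟨x, hx.1⟩ hcl hcv (u k)
    set q := metricProj S (u k)
    have e3 : ‖v - x‖ ^ 2 ≤ ‖v - (x - lam k • F x)‖ ^ 2 - 2 * (lam k * inner ℝ (F x) (v - x)) := by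
      have e4 : v - (x - lam k • F x) = (v - x) + lam k • F x := by abel
      rw [e4, norm_add_sq_real, inner_smul_right, real_inner_comm]
      linarith [sq_nonneg ‖lam k • F x‖]
    have e5 : v - x = (u k - q) + (q - x) - lam k • F (u k) := by rw [hv]; abel
    have e6 : -(‖F x‖ * (Metric.infDist (u k) S + lam k * G)) ≤ inner ℝ (F x) (v - x) := by
      rw [e5, inner_sub_right, inner_add_right, inner_smul_right]
      have f1 := (abs_le.1 (abs_real_inner_le_norm (F x) (u k - q))).1
      have f2 := hx.2 q hq.1
      have f3 : inner ℝ (F x) (F (u k)) ≤ ‖F x‖ * G :=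
        (real_inner_le_norm _ _).trans (mul_le_mul_of_nonneg_left (hG k) (norm_nonneg _))
      have f4 := mul_le_mul_of_nonneg_left f3 (hlam k)
      rw [hqD] at f1
      linarith
    have e7 := mul_le_mul_of_nonneg_left e6 (hlam k)
    have e8 : 0 ≤ ε ^ 2 * ‖metricProj (halfSpace (u k) (T k (u k))) v - v‖ ^ 2 := by positivity
    linarith
  rw [tendsto_iff_norm_sub_tendsto_zero]
  simpa [Real.sqrt_sq (norm_nonneg _)] using hs.sqrt

end OuterApproximation


/-! ### The three methods yield cutters with covering controls -/

section Methods

variable {H : Type*} [NormedAddCommGroup H] [InnerProductSpace ℝ H] {S : Set H}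
  {U L T : ℕ → H → H} {β γ : ℕ → ℝ}

/-- `T` consists of cutters with respect to `S` and controls two families of functions `d₁`, `d₂`,
each of whose members is active at least once in every string of `p` indices. -/
def HasCoveringControls {ι₁ ι₂ : Type*} (S : Set H) (T : ℕ → H → H) (d₁ : ι₁ → H → ℝ)
    (d₂ : ι₂ → H → ℝ) (p : ℕ) : Prop :=
  (∀ k, IsSQNEOn 1 S (T k)) ∧
    (∃ K : ℕ → Set ι₁, Controls T d₁ K ∧ ∀ k i, ∃ l < p, i ∈ K (k + l)) ∧
    ∃ K : ℕ → Set ι₂, Controls T d₂ K ∧ ∀ k i, ∃ l < p, i ∈ K (k + l)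

variable {z : H} {β₀ γ₀ : ℝ} {ι₁ ι₂ : Type*} {d₁ : ι₁ → H → ℝ} {d₂ : ι₂ → H → ℝ}
  {I : ℕ → Set ι₁} {J : ℕ → Set ι₂} {s : ℕ}

lemma IsProductMethod.hasCoveringControls (hT : IsProductMethod U L β γ T) (hz : z ∈ S)
    (hU : ∀ k, IsSQNEOn (β k) S (U k)) (hL : ∀ k, IsSQNEOn (γ k) S (L k))
    (hβ₀ : 0 < β₀) (hβ : ∀ k, β₀ ≤ β k) (hγ₀ : 0 < γ₀) (hγ : ∀ k, γ₀ ≤ γ k)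
    (hUI : Controls U d₁ I) (hLJ : Controls L d₂ J) (hd₁ : ∀ i x y, d₁ i x ≤ d₁ i y + ‖x - y‖)
    (hI : ∀ k i, ∃ l < s, i ∈ I (k + l)) (hJ : ∀ k i, ∃ l < s, i ∈ J (k + l)) :
    HasCoveringControls S T d₁ d₂ s := by
  obtain ⟨ρ, hρ, hT⟩ := hT
  obtain rfl : T = fun k => relax ((1 + ρ k) / 2) (fun y => U k (L k y)) :=
    funext fun k => funext (hT k)
  refine ⟨fun k => ?_, ⟨I, ?_, hI⟩, J, ?_, hJ⟩
  · exact (IsSQNEOn.comp (hβ₀.trans_le (hβ k)) (hγ₀.trans_le (hγ k)) (hρ k).2 (hU k) (hL k)).relax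
      (hρ k).1
  · exact (hUI.comp_left hz hU hL hβ₀ hβ hγ₀ hγ hd₁).relax fun k => (hρ k).1
  · exact (hLJ.comp_right hz hU hL (fun k => hβ₀.le.trans (hβ k)) hγ₀ hγ).relax fun k => (hρ k).1

lemma IsSimultaneousMethod.hasCoveringControls (hT : IsSimultaneousMethod U L β γ T) (hz : z ∈ S)
    (hU : ∀ k, IsSQNEOn (β k) S (U k)) (hL : ∀ k, IsSQNEOn (γ k) S (L k))
    (hβ : ∀ k, 0 < β k) (hγ : ∀ k, 0 < γ k)
    (hUI : Controls U d₁ I) (hLJ : Controls L d₂ J)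
    (hI : ∀ k i, ∃ l < s, i ∈ I (k + l)) (hJ : ∀ k i, ∃ l < s, i ∈ J (k + l)) :
    HasCoveringControls S T d₁ d₂ s := by
  obtain ⟨η₀, η, ρ, hη₀, hη, hρ, hT⟩ := hT
  obtain rfl : T = fun k => relax ((1 + ρ k) / 2) (fun y => η k • U k y + (1 - η k) • L k y) :=
    funext fun k => funext (hT k)
  have hη0 : ∀ k, 0 < η k := fun k => hη₀.trans_le (hη k).1
  have hη1 : ∀ k, η k < 1 := fun k => by linarith [(hη k).2]
  refine ⟨fun k => ?_, ⟨I, ?_, hI⟩, J, ?_, hJ⟩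
  · exact (IsSQNEOn.combination (hβ k) (hγ k) (hη0 k) (hη1 k) (hρ k).2 (hU k) (hL k)).relax
      (hρ k).1
  · exact (hUI.combination_left hz hU hL (fun k => (hβ k).le) (fun k => (hγ k).le) hη₀
      (fun k => (hη k).1) (fun k => (hη1 k).le)).relax fun k => (hρ k).1
  · exact (hLJ.combination_right hz hU hL (fun k => (hβ k).le) (fun k => (hγ k).le) hη₀
      (fun k => (hη k).2) (fun k => (hη0 k).le)).relax fun k => (hρ k).1

lemma IsAlternatingMethod.hasCoveringControls (hT : IsAlternatingMethod U L β γ T)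
    (hU : ∀ k, IsSQNEOn (β k) S (U k)) (hL : ∀ k, IsSQNEOn (γ k) S (L k))
    (hβ : ∀ k, 0 ≤ β k) (hγ : ∀ k, 0 ≤ γ k)
    (hUI : Controls U d₁ I) (hLJ : Controls L d₂ J)
    (hI : ∀ k i, ∃ l < s, i ∈ I (k + l)) (hJ : ∀ k i, ∃ l < s, i ∈ J (k + l)) :
    HasCoveringControls S T d₁ d₂ (2 * s + 2) := by
  refine ⟨fun k => ?_, ⟨_, (hUI.relax hβ).of_two_mul_add 0 (by norm_num) fun k x => (hT k x).1,
    exists_mem_of_two_mul_add hI 0 (by norm_num)⟩, _,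
    (hLJ.relax hγ).of_two_mul_add 1 (by norm_num) fun k x => (hT k x).2,
    exists_mem_of_two_mul_add hJ 1 (by norm_num)⟩
  obtain ⟨q, rfl | rfl⟩ := Nat.even_or_odd' k
  · rw [show T (2 * q) = _ from funext fun x => (hT q x).1]
    exact (hU q).relax (hβ q)
  · rw [show T (2 * q + 1) = _ from funext fun x => (hT q x).2]
    exact (hL q).relax (hγ q)

end Methods

lemma IsIntermittent.exists_mem {m s : ℕ} {I : ℕ → Finset (Fin m)} (h : IsIntermittent s I)
    (k : ℕ) (i : Fin m) : ∃ l < s, i ∈ (I (k + l) : Set (Fin m)) := by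
  have hi : i ∈ (Finset.range s).biUnion (fun l => I (k + l)) := by
    rw [h k]
    exact Finset.mem_univ i
  simpa using hi

lemma infDist_le_infDist_add_norm {H : Type*} [NormedAddCommGroup H] (D : Set H) (x y : H) :
    Metric.infDist x D ≤ Metric.infDist y D + ‖x - y‖ := by
  rw [← dist_eq_norm]
  exact Metric.infDist_le_infDist_add_dist

/-! ### From covering controls to the solution set -/

section SolutionSet

variable {H₁ H₂ : Type*} [NormedAddCommGroup H₁] [InnerProductSpace ℝ H₁] [CompleteSpace H₁]
  [NormedAddCommGroup H₂] [InnerProductSpace ℝ H₂] [CompleteSpace H₂] {m n : ℕ}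
  {A : H₁ →L[ℝ] H₂} {C : Fin m → Set H₁} {Q : Fin n → Set H₂}

omit [CompleteSpace H₁] [CompleteSpace H₂] in
lemma isClosed_solutionSet (hC : ∀ i, IsClosed (C i)) (hQ : ∀ j, IsClosed (Q j)) :
    IsClosed (solutionSet A C Q) :=
  (isClosed_iInter hC).inter ((isClosed_iInter hQ).preimage A.continuous)

omit [CompleteSpace H₁] [CompleteSpace H₂] in
lemma convex_solutionSet (hC : ∀ i, Convex ℝ (C i)) (hQ : ∀ j, Convex ℝ (Q j)) :
    Convex ℝ (solutionSet A C Q) :=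
  (convex_iInter hC).inter ((convex_iInter hQ).linear_preimage A.toLinearMap)

/-- Covering controls of the distances to the constraint sets make the iterates of the outer
approximation method approach the solution set wherever displacements and steps are small. -/
lemma HasCoveringControls.infDist_solutionSet_lt {T : ℕ → H₁ → H₁} {p : ℕ}
    (hS : (solutionSet A C Q).Nonempty)
    (hT : HasCoveringControls (solutionSet A C Q) T (fun i x => Metric.infDist x (C i))
      (fun j x => Metric.infDist (A x) (Q j)) p)
    (hA : IsClosed (range A))
    (hC : BoundedlyRegular (Fin.cons (A ⁻¹' (⋂ j, Q j)) C : Fin (m + 1) → Set H₁))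
    (hQ : BoundedlyRegular (Fin.cons (range A) Q : Fin (n + 1) → Set H₂))
    {u : ℕ → H₁} {M : ℝ} (hu : ∀ k, ‖u k‖ ≤ M) (ε : ℝ) (hε : 0 < ε) :
    ∃ δ > 0, ∃ N, ∀ k ≥ N, (∀ l < p, ‖T (k + l) (u (k + l)) - u (k + l)‖ < δ) →
      (∀ l < p, ‖u (k + l + 1) - u (k + l)‖ < δ) →
      Metric.infDist (u k) (solutionSet A C Q) < ε := by
  obtain ⟨-, ⟨K₁, hK₁, hp₁⟩, K₂, hK₂, hp₂⟩ := hT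
  obtain ⟨δ, hδ, h⟩ := SplitVI.infDist_solutionSet_lt hS hA hC hQ M ε hε
  obtain ⟨δ₁, hδ₁, N₁, h₁⟩ := hK₁.lt_of_small_steps zero_le_one (fun i x y => by
    rw [one_mul]
    exact infDist_le_infDist_add_norm _ _ _) hp₁ hu δ hδ
  obtain ⟨δ₂, hδ₂, N₂, h₂⟩ := hK₂.lt_of_small_steps (norm_nonneg A) (fun j x y => by
    refine (infDist_le_infDist_add_norm _ _ (A y)).trans (add_le_add le_rfl ?_)
    rw [← map_sub]
    exact A.le_opNorm _) hp₂ hu δ hδ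
  refine ⟨min δ₁ δ₂, by positivity, max N₁ N₂, fun k hk hd hs => h (u k) (hu k) ?_ ?_⟩
  · exact h₁ k ((le_max_left _ _).trans hk) (fun l hl => (hd l hl).trans_le (min_le_left _ _))
      (fun l hl => (hs l hl).trans_le (min_le_left _ _))
  · exact h₂ k ((le_max_right _ _).trans hk) (fun l hl => (hd l hl).trans_le (min_le_right _ _))
      (fun l hl => (hs l hl).trans_le (min_le_right _ _))

end SolutionSet

end SplitVI

/-! ### The main theorem -/

theorem mainTheorem1
    {H₁ H₂ : Type*} [NormedAddCommGroup H₁] [InnerProductSpace ℝ H₁] [CompleteSpace H₁]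
    [NormedAddCommGroup H₂] [InnerProductSpace ℝ H₂] [CompleteSpace H₂]
    -- the operator of the variational inequality
    (F : H₁ → H₁) (L : ℝ≥0) (α : ℝ)
    (hFL : LipschitzWith L F) (hFα : SplitVI.IsStronglyMonotone α F)
    -- the split convex feasibility problem
    (A : H₁ →L[ℝ] H₂) (hA : A ≠ 0)
    {m n : ℕ} (C : Fin m → Set H₁) (Q : Fin n → Set H₂)
    (hC : ∀ i, IsClosed (C i) ∧ Convex ℝ (C i))
    (hQ : ∀ j, IsClosed (Q j) ∧ Convex ℝ (Q j))
    (hS : (SplitVI.solutionSet A C Q).Nonempty)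
    -- the strongly quasi-nonexpansive operators
    (U : ℕ → H₁ → H₁) (β : ℕ → ℝ)
    (hU : ∀ k, SplitVI.IsSQNE (β k) (U k))
    (hUfix : ∀ k, (⋂ i, C i) ⊆ Function.fixedPoints (U k))
    (hβ : 0 < ⨅ k, β k)
    (V : ℕ → H₂ → H₂) (γ : ℕ → ℝ)
    (hV : ∀ k, SplitVI.IsSQNE (γ k) (V k))
    (hVfix : ∀ k, (⋂ j, Q j) ⊆ Function.fixedPoints (V k))
    (hγ : 0 < ⨅ k, γ k)
    -- the extrapolation functionals
    (σ : ℕ → H₁ → ℝ)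
    (hσ : ∀ k x, 1 ≤ σ k x ∧ σ k x ≤ SplitVI.extrapolationBound A (V k) x)
    -- the algorithmic operators: (i) product, (ii) simultaneous or (iii) alternating
    (T : ℕ → H₁ → H₁)
    (hT : SplitVI.IsProductMethod U (fun k => SplitVI.landweber A (σ k) (V k)) β γ T ∨
      SplitVI.IsSimultaneousMethod U (fun k => SplitVI.landweber A (σ k) (V k)) β γ T ∨
      SplitVI.IsAlternatingMethod U (fun k => SplitVI.landweber A (σ k) (V k)) β γ T)
    -- the outer approximation method
    (ε : ℝ) (hε : 0 < ε) (a : ℕ → ℝ) (ha : ∀ k, ε ≤ a k ∧ a k ≤ 2 - ε)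
    (lam : ℕ → ℝ) (hlam : ∀ k, 0 ≤ lam k)
    (u : ℕ → H₁) (hu : SplitVI.IsOuterApproximation F T a lam u)
    -- regularity of the operators and intermittent controls
    (I : ℕ → Finset (Fin m)) (hI : ∀ k, (I k).Nonempty)
    (J : ℕ → Finset (Fin n)) (hJ : ∀ k, (J k).Nonempty)
    (hUreg : SplitVI.RegularAlong U C I hI)
    (hVreg : SplitVI.RegularAlong V Q J hJ)
    (s : ℕ) (hs : 1 ≤ s)
    (hIs : SplitVI.IsIntermittent s I) (hJs : SplitVI.IsIntermittent s J)
    -- regularity of the sets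
    (hAclosed : IsClosed (range A))
    (hCreg : SplitVI.BoundedlyRegular
      (Fin.cons (A ⁻¹' (⋂ j, Q j)) C : Fin (m + 1) → Set H₁))
    (hQreg : SplitVI.BoundedlyRegular
      (Fin.cons (range A) Q : Fin (n + 1) → Set H₂))
    (hlam0 : Tendsto lam atTop (𝓝 0)) :
    Tendsto (fun k => Metric.infDist (u k) (SplitVI.solutionSet A C Q)) atTop (𝓝 0) ∧
    (Tendsto (fun N => ∑ k ∈ Finset.range N, lam k) atTop atTop →
      ∃ x : H₁, SplitVI.IsVISolution F (SplitVI.solutionSet A C Q) x ∧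
        (∀ y, SplitVI.IsVISolution F (SplitVI.solutionSet A C Q) y → y = x) ∧
        Tendsto u atTop (𝓝 x)) := by
  have hβ₀ : ∀ k, (⨅ k, β k) ≤ β k := ciInf_le ⟨0, by rintro _ ⟨k, rfl⟩; exact (hU k).nonneg⟩
  have hγ₀ : ∀ k, (⨅ k, γ k) ≤ γ k := ciInf_le ⟨0, by rintro _ ⟨k, rfl⟩; exact (hV k).nonneg⟩
  obtain ⟨z, hz⟩ := id hS
  have hVD : ∀ k, SplitVI.IsSQNEOn (γ k) (⋂ j, Q j) (V k) := fun k => (hV k).isSQNEOn (hVfix k)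
  have hUS : ∀ k, SplitVI.IsSQNEOn (β k) (SplitVI.solutionSet A C Q) (U k) := fun k =>
    (hU k).isSQNEOn fun x hx => hUfix k hx.1
  have hLS : ∀ k, SplitVI.IsSQNEOn (γ k) (SplitVI.solutionSet A C Q)
      (SplitVI.landweber A (σ k) (V k)) := fun k x w hw =>
    SplitVI.isSQNEOn_landweber hA (hV k).nonneg (hVD k) (hσ k) x w hw.2
  have hUI := hUreg.controls (z := z) fun k => hUfix k hz.1
  have hLJ := SplitVI.Controls.landweber hA (fun k => (hV k).nonneg) hVD
    (fun k x => (hσ k x).1) hz.2 (hVreg.controls (z := A z) fun k => hVfix k hz.2)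
  -- The only point where the three methods differ; interleaving lengthens the window from `s` to `2
  -- * s + 2`.
  obtain ⟨p, hp, hTp⟩ : ∃ p, 1 ≤ p ∧ SplitVI.HasCoveringControls (SplitVI.solutionSet A C Q) T
      (fun i x => Metric.infDist x (C i)) (fun j x => Metric.infDist (A x) (Q j)) p := by
    rcases hT with hT | hT | hT
    · exact ⟨s, hs, hT.hasCoveringControls hz hUS hLS hβ hβ₀ hγ hγ₀ hUI hLJ
        (fun i => SplitVI.infDist_le_infDist_add_norm _) hIs.exists_mem hJs.exists_mem⟩
    · exact ⟨s, hs, hT.hasCoveringControls hz hUS hLS (fun k => hβ.trans_le (hβ₀ k))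
        (fun k => hγ.trans_le (hγ₀ k)) hUI hLJ hIs.exists_mem hJs.exists_mem⟩
    · exact ⟨2 * s + 2, by omega, hT.hasCoveringControls hUS hLS (fun k => (hU k).nonneg)
        (fun k => (hV k).nonneg) hUI hLJ hIs.exists_mem hJs.exists_mem⟩
  have hcl : IsClosed (SplitVI.solutionSet A C Q) :=
    SplitVI.isClosed_solutionSet (fun i => (hC i).1) fun j => (hQ j).1
  have hcv : Convex ℝ (SplitVI.solutionSet A C Q) :=
    SplitVI.convex_solutionSet (fun i => (hC i).2) fun j => (hQ j).2
  have hsmall : ∀ᶠ k in atTop, lam k * (L : ℝ) ^ 2 ≤ α ∧ lam k * α ≤ 1 := by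
    have h1 : Tendsto (fun k => lam k * (L : ℝ) ^ 2) atTop (𝓝 0) := by
      simpa using hlam0.mul_const ((L : ℝ) ^ 2)
    have h2 : Tendsto (fun k => lam k * α) atTop (𝓝 0) := by simpa using hlam0.mul_const α
    filter_upwards [h1.eventually (gt_mem_nhds hFα.1), h2.eventually (gt_mem_nhds one_pos)]
      with k hk1 hk2 using ⟨hk1.le, hk2.le⟩
  obtain ⟨M, hM⟩ := hu.exists_norm_le hTp.1 hS hε ha hFL hFα hlam hsmall
  have hG : ∀ k, ‖F (u k)‖ ≤ ‖F 0‖ + L * M := fun k => by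
    have h1 := hFL.dist_le_mul (u k) 0
    rw [dist_eq_norm, dist_zero_right] at h1
    have h2 := norm_add_le (F (u k) - F 0) (F 0)
    rw [sub_add_cancel] at h2
    have h3 := mul_le_mul_of_nonneg_left (hM k) L.coe_nonneg
    linarith
  have hdist := hu.tendsto_infDist hTp.1 hS hcl hcv hε ha hlam hlam0 hM hG hp fun e he =>
    hTp.infDist_solutionSet_lt hS hAclosed hCreg hQreg hM e he
  refine ⟨hdist, fun hsum => ?_⟩
  obtain ⟨x, hx⟩ := SplitVI.exists_isVISolution hS hcl hcv hFL hFα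
  exact ⟨x, hx, fun y hy => SplitVI.IsVISolution.eq hFα hx hy,
    hu.tendsto_of_tendsto_infDist hTp.1 hcl hcv hε ha hFL hFα hlam hsmall hlam0 hG hdist hsum hx⟩
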